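/- **Theorem 5.3 (hardness of high-accuracy log-determinant estimation).** *The estimation problem.* Let $\kappa,s,\tau$ be polynomials with natural-number coefficients, $\kappa(n)>0$ for all $n$, and let $\varepsilon:\mathbb N\to(0,\infty)$. An instance of $\mathrm{LOGDET}_{\kappa,s,\tau,\varepsilon}$ consists of $n\in\mathbb N$ (in unary) and the codes of three deterministic programs that give *sparse access in time $\tau(n)$* to a positive semidefinite matrix $A\in\mathbb C^{2^n\times 2^n}$ with spectrum contained in $[\tfrac1{\kappa(n)},1]$ and with at most $s(n)$ non-zero entries in each row and each column. That is, each program halts after at most $\tau(n)$ steps on the inputs in question; the first returns $A(i,j)$ on input $(i,j)\in[2^n]\times[2^n]$; the second (third) returns on input $(i,l)\in[2^n]\times[s(n)]$ the $l$-th non-zero entry of the $i$-th row (column) of $A$ together with its column (row) index, or an error message if there are fewer than $l$ non-zero entries. Entries are returned exactly, as $(a+b\,\mathrm i)/2^k$ with $a,b\in\mathbb Z$, $k\in\mathbb N$. A correct answer to the instance is any number $z$ with $|z-\log\det(A)|\le\varepsilon(n)$. *Hardness.* For a class $\mathsf C$ of promise problems, $\mathrm{LOGDET}_{\kappa,s,\tau,\varepsilon}$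 is $\mathsf C$-hard if for every $L=(L_{\mathrm{yes}},L_{\mathrm{no}})\in\mathsf C$ there are polynomial-time computable functions $f,g$ such that for every $x\in L_{\mathrm{yes}}\cup L_{\mathrm{no}}$ the string $f(x)$ is an instance and, for every correct answer $z$ to $f(x)$ that has a finite binary expansion, $g(x,z)$ accepts if $x\in L_{\mathrm{yes}}$ and rejects if $x\in L_{\mathrm{no}}$. *Classes.* $L\in\mathsf{BQP}$ if there is a polynomial-time generated family of quantum circuits $Q_x$ over the gates $H$, $T=\mathrm{diag}(1,e^{\mathrm i\pi/4})$, $\mathrm{CNOT}$ with $|\langle 0\cdots0|Q_x|0\cdots0\rangle|^2\ge\frac23$ for $x\in L_{\mathrm{yes}}$ and $\le\frac13$ for $x\in L_{\mathrm{no}}$. $L\in\mathsf{PP}$ if there is a polynomial-time probabilistic machine that accepts with probability at least $\frac12$ for $x\in L_{\mathrm{yes}}$ and less than $\frac12$ for $x\in L_{\mathrm{no}}$. *Claim.* There are polynomials $\kappa,s,\tau$ with natural-number coefficients, $\kappa(n)>0$ for all $n$, such that 1. for some polynomial $p$ with natural-number coefficients and $p(n)>0$ for all $n$, the problem $\mathrm{LOGDET}_{\kappa,s,\tau,\varepsilon}$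 with $\varepsilon(n)=\frac1{p(n)}$ is $\mathsf{BQP}$-hard, and 2. the problem $\mathrm{LOGDET}_{\kappa,s,\tau,\varepsilon}$ with $\varepsilon(n)=e^{-n}$ is $\mathsf{PP}$-hard. -/

import Mathlib

namespace LogDetHardness

open scoped ComplexOrder

/-! ## Machine model: programs on bit stacks, with a step count

A program works on registers, each of which holds a stack of bits. Every elementary step reads or
changes only the top of one register, so a program is a multi-stack (equivalently multi-tape)
machine in structured form. Up to polynomial factors its running time is Turing-machine time. -/

/-- The contents of the registers; the head of the list is the top of the stack. -/
abbrev Store := ℕ → List Bool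

/-- Programs. -/
inductive Prog : Type
  /-- do nothing -/
  | skip : Prog
  /-- push the bit `b` on register `r` -/
  | push (r : ℕ) (b : Bool) : Prog
  /-- remove the top bit of register `r` (no effect on an empty register) -/
  | pop (r : ℕ) : Prog
  /-- run `p`, then `q` -/
  | seq (p q : Prog) : Prog
  /-- three-way branch: register `r` is empty, has top bit `false`, has top bit `true` -/
  | branch (r : ℕ) (pNil pFalse pTrue : Prog) : Prog
  /-- while register `r` is not empty, run `p` -/
  | loop (r : ℕ) (p : Prog) : Prog

/-- `Exec P σ σ' t`: started in the store `σ`, the program `P` halts in the store `σ'` after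
exactly `t` elementary steps (instructions and tests). -/
inductive Exec : Prog → Store → Store → ℕ → Prop
  | skip (σ : Store) : Exec Prog.skip σ σ 1
  | push (r : ℕ) (b : Bool) (σ : Store) :
      Exec (Prog.push r b) σ (Function.update σ r (b :: σ r)) 1
  | pop (r : ℕ) (σ : Store) :
      Exec (Prog.pop r) σ (Function.update σ r (σ r).tail) 1
  | seq {p q : Prog} {σ σ' σ'' : Store} {t t' : ℕ} :
      Exec p σ σ' t → Exec q σ' σ'' t' → Exec (Prog.seq p q) σ σ'' (t + t')
  | branchNil {r : ℕ} {pNil pFalse pTrue : Prog} {σ σ' : Store} {t : ℕ} :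
      σ r = [] → Exec pNil σ σ' t →
        Exec (Prog.branch r pNil pFalse pTrue) σ σ' (t + 1)
  | branchFalse {r : ℕ} {pNil pFalse pTrue : Prog} {σ σ' : Store} {t : ℕ} :
      (σ r).head? = some false → Exec pFalse σ σ' t →
        Exec (Prog.branch r pNil pFalse pTrue) σ σ' (t + 1)
  | branchTrue {r : ℕ} {pNil pFalse pTrue : Prog} {σ σ' : Store} {t : ℕ} :
      (σ r).head? = some true → Exec pTrue σ σ' t →
        Exec (Prog.branch r pNil pFalse pTrue) σ σ' (t + 1)
  | loopNil {r : ℕ} {p : Prog} {σ : Store} :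
      σ r = [] → Exec (Prog.loop r p) σ σ 1
  | loopCons {r : ℕ} {p : Prog} {σ σ' σ'' : Store} {t t' : ℕ} :
      σ r ≠ [] → Exec p σ σ' t → Exec (Prog.loop r p) σ' σ'' t' →
        Exec (Prog.loop r p) σ σ'' (t + t' + 1)

/-- The initial store: the arguments are in the first registers, all others are empty. -/
def inputs (args : List (List Bool)) : Store := fun r => args.getD r []

/-- On the given arguments, `P` halts after at most `T` steps in a store that satisfies `post`. -/
def Prog.RunsTo (P : Prog) (args : List (List Bool)) (T : ℕ) (post : Store → Prop) : Prop :=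
  ∃ (σ : Store) (t : ℕ), Exec P (inputs args) σ t ∧ t ≤ T ∧ post σ

/-- Polynomial-time computable functions of `k` bit strings; the value is left in register `0`. -/
def PolyTime {k : ℕ} (f : (Fin k → List Bool) → List Bool) : Prop :=
  ∃ (P : Prog) (q : Polynomial ℕ), ∀ args : Fin k → List Bool,
    P.RunsTo (List.ofFn args) (q.eval (∑ i, (args i).length)) (fun σ => σ 0 = f args)

/-- The self-delimiting unary code `1 ⋯ 1 0` of a natural number. -/
def unary (m : ℕ) : List Bool := List.replicate m true ++ [false]

/-- Programs as bit strings (a prefix code). -/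
def Prog.encode : Prog → List Bool
  | Prog.skip => [false, false, false]
  | Prog.push r b => [false, false, true] ++ unary r ++ [b]
  | Prog.pop r => [false, true, false] ++ unary r
  | Prog.seq p q => [false, true, true] ++ p.encode ++ q.encode
  | Prog.branch r p q q' => [true, false] ++ unary r ++ p.encode ++ q.encode ++ q'.encode
  | Prog.loop r p => [true, true] ++ unary r ++ p.encode

/-! ## Promise problems, BQP and PP -/

/-- A promise problem over bit strings. -/
structure PromiseProblem where
  yes : Set (List Bool)
  no : Set (List Bool)
  disjoint : Disjoint yes no

/-- The gates (Clifford + T) on `n` qubits: Hadamard, `T = diag(1, exp(iπ/4))`, and CNOT with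
control `c` and target `t`. -/
inductive Gate (n : ℕ) : Type
  | H (q : Fin n) : Gate n
  | T (q : Fin n) : Gate n
  | CNOT (c t : Fin n) (h : c ≠ t) : Gate n

/-- The unitary matrix of a gate in the computational basis. -/
noncomputable def Gate.matrix {n : ℕ} : Gate n → Matrix (Fin n → Bool) (Fin n → Bool) ℂ
  | Gate.H q => Matrix.of fun y x =>
      if ∀ k, k ≠ q → y k = x k then
        (if y q = true ∧ x q = true then -1 else 1) / (Real.sqrt 2 : ℂ)
      else 0
  | Gate.T q => Matrix.diagonal fun x =>
      if x q = true then Complex.exp (Real.pi / 4 * Complex.I) else 1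
  | Gate.CNOT c t _ => Matrix.of fun y x =>
      if y = Function.update x t (xor (x t) (x c)) then 1 else 0

/-- The unitary `U_T ⋯ U_1` of a circuit whose gates, in the order of application, are listed. -/
noncomputable def circuitMatrix {n : ℕ} :
    List (Gate n) → Matrix (Fin n → Bool) (Fin n → Bool) ℂ
  | [] => 1
  | g :: c => circuitMatrix c * g.matrix

/-- The acceptance probability `|⟨0…0| Q |0…0⟩|²` of a circuit `Q`. -/
noncomputable def acceptProb {n : ℕ} (Q : List (Gate n)) : ℝ :=
  ‖circuitMatrix Q (fun _ => false) (fun _ => false)‖ ^ 2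

/-- Gates as bit strings. -/
def Gate.encode {n : ℕ} : Gate n → List Bool
  | Gate.H q => [false, false] ++ unary q
  | Gate.T q => [false, true] ++ unary q
  | Gate.CNOT c t _ => [true] ++ unary c ++ unary t

/-- The bit-string description of a circuit on `n` qubits. Its length is at least the number of
qubits and at least the number of gates. -/
def encodeCircuit (n : ℕ) (Q : List (Gate n)) : List Bool :=
  unary n ++ Q.flatMap Gate.encode

/-- BQP: promise problems decided, with acceptance probability at least `2/3` on yes-inputs and at
most `1/3` on no-inputs, by a polynomial-time generated family of quantum circuits. -/
def BQP : Set PromiseProblem :=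
  {L | ∃ f : (Fin 1 → List Bool) → List Bool, PolyTime f ∧
    (∀ x ∈ L.yes, ∃ (n : ℕ) (Q : List (Gate n)),
      f ![x] = encodeCircuit n Q ∧ 2 / 3 ≤ acceptProb Q) ∧
    (∀ x ∈ L.no, ∃ (n : ℕ) (Q : List (Gate n)),
      f ![x] = encodeCircuit n Q ∧ acceptProb Q ≤ 1 / 3)}

/-- The probability that `V` accepts `x` (returns the bit `1`) when it is given `m` independent
uniformly random bits. -/
noncomputable def randAcceptProb (V : (Fin 2 → List Bool) → List Bool) (m : ℕ) (x : List Bool) :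
    ℝ :=
  ({r : Fin m → Bool | V ![x, List.ofFn r] = [true]}.ncard : ℝ) / 2 ^ m

/-- PP: promise problems decided by a probabilistic polynomial-time machine that accepts
yes-inputs with probability at least `1/2` and no-inputs with probability less than `1/2`. The
random bits of the machine are a second argument of polynomial length. -/
def PP : Set PromiseProblem :=
  {L | ∃ (V : (Fin 2 → List Bool) → List Bool) (m : Polynomial ℕ), PolyTime V ∧
    (∀ x ∈ L.yes, 1 / 2 ≤ randAcceptProb V (m.eval x.length) x) ∧
    (∀ x ∈ L.no, randAcceptProb V (m.eval x.length) x < 1 / 2)}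

/-! ## Numbers as bit strings -/

/-- A signed integer in binary: a sign bit (`true` for negative), then the binary digits of the
absolute value, least significant first. -/
def intVal : List Bool → ℤ
  | [] => 0
  | b :: w => (if b then -1 else 1) * (Nat.ofDigits 2 (w.map Bool.toNat) : ℤ)

/-- The real number with finite binary expansion `a / 2 ^ |k|`. -/
noncomputable def realVal (a k : List Bool) : ℝ := (intVal a : ℝ) / 2 ^ k.length

/-- The complex number `(a + b i) / 2 ^ |k|`. -/
noncomputable def complexVal (a b k : List Bool) : ℂ :=
  ((intVal a : ℂ) + (intVal b : ℂ) * Complex.I) / 2 ^ k.length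

/-! ## Estimation problems and their hardness -/

/-- A problem that asks to estimate a real number from an instance given as a bit string. -/
structure EstimationProblem where
  /-- the bit string is an instance (it satisfies the promise) -/
  IsInstance : List Bool → Prop
  /-- the number is a correct answer to the instance -/
  IsEstimate : List Bool → ℝ → Prop

/-- A polynomial-time reduction of a promise problem to an estimation problem: `f` maps each input
`x` to an instance, and from `x` and any correct estimate for that instance (in binary) `g`
decides whether `x` is a yes- or a no-input. -/
def ReducesTo (L : PromiseProblem) (R : EstimationProblem) : Prop :=
  ∃ (f : (Fin 1 → List Bool) → List Bool) (g : (Fin 3 → List Bool) → List Bool),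
    PolyTime f ∧ PolyTime g ∧
    ∀ x ∈ L.yes ∪ L.no, R.IsInstance (f ![x]) ∧
      ∀ a k : List Bool, R.IsEstimate (f ![x]) (realVal a k) →
        (x ∈ L.yes → g ![x, a, k] = [true]) ∧ (x ∈ L.no → g ![x, a, k] = [false])

/-- Every promise problem of the class `C` reduces to `R` in polynomial time. -/
def IsHard (C : Set PromiseProblem) (R : EstimationProblem) : Prop :=
  ∀ L ∈ C, ReducesTo L R

/-! ## Sparse access and the log-determinant problem -/

/-- An index in `[2 ^ n]` as its `n` binary digits, least significant first. -/
def indexBits {n : ℕ} (i : Fin (2 ^ n)) : List Bool :=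
  List.ofFn fun k : Fin n => (i : ℕ).testBit k

/-- The final store `σ` reports the non-zero entry number `l` (counted from `0`, in increasing
order of the index) of the vector `v`: register `0` holds `1`, register `1` the index, registers
`2`, `3`, `4` the entry. If `v` has at most `l` non-zero entries, register `0` holds the error
message `0`. -/
def ReportsNonzero {n : ℕ} (v : Fin (2 ^ n) → ℂ) (l : ℕ) (σ : Store) : Prop :=
  (∃ j, v j ≠ 0 ∧ {j' | j' < j ∧ v j' ≠ 0}.ncard = l ∧
    σ 0 = [true] ∧ σ 1 = indexBits j ∧ complexVal (σ 2) (σ 3) (σ 4) = v j) ∨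
  ({j | v j ≠ 0}.ncard ≤ l ∧ σ 0 = [false])

/-- The programs `entry`, `row`, `col` give sparse access in time `T` to the `s`-sparse matrix
`A`. The number `l < s` is passed in unary. -/
structure SparseAccess {n : ℕ} (A : Matrix (Fin (2 ^ n)) (Fin (2 ^ n)) ℂ) (s T : ℕ)
    (entry row col : Prog) : Prop where
  row_sparse : ∀ i, {j | A i j ≠ 0}.ncard ≤ s
  col_sparse : ∀ j, {i | A i j ≠ 0}.ncard ≤ s
  entry_spec : ∀ i j, entry.RunsTo [indexBits i, indexBits j] T
    fun σ => complexVal (σ 0) (σ 1) (σ 2) = A i j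
  row_spec : ∀ i, ∀ l < s, row.RunsTo [indexBits i, List.replicate l true] T
    fun σ => ReportsNonzero (fun j => A i j) l σ
  col_spec : ∀ j, ∀ l < s, col.RunsTo [indexBits j, List.replicate l true] T
    fun σ => ReportsNonzero (fun i => A i j) l σ

/-- The bit string `w` describes `n` (in unary) and programs that give sparse access, in time
`τ(n)`, to the `s(n)`-sparse positive semidefinite `2 ^ n × 2 ^ n` matrix `A`, whose spectrum lies
in `[1 / κ(n), 1]`. -/
def DescribesMatrix (κ s τ : Polynomial ℕ) (w : List Bool) (n : ℕ)
    (A : Matrix (Fin (2 ^ n)) (Fin (2 ^ n)) ℂ) : Prop :=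
  (∃ entry row col : Prog,
    w = unary n ++ entry.encode ++ row.encode ++ col.encode ∧
    SparseAccess A (s.eval n) (τ.eval n) entry row col) ∧
  A.PosSemidef ∧ spectrum ℝ A ⊆ Set.Icc (1 / ((κ.eval n : ℕ) : ℝ)) 1

/-- Estimating `log det A` to additive accuracy `ε(n)`, given sparse access to `A`. The
determinant of a positive semidefinite matrix is real. -/
noncomputable def logDetEstimation (κ s τ : Polynomial ℕ) (ε : ℕ → ℝ) : EstimationProblem where
  IsInstance w := ∃ (n : ℕ) (A : Matrix (Fin (2 ^ n)) (Fin (2 ^ n)) ℂ), DescribesMatrix κ s τ w n A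
  IsEstimate w z := ∃ (n : ℕ) (A : Matrix (Fin (2 ^ n)) (Fin (2 ^ n)) ℂ),
    DescribesMatrix κ s τ w n A ∧ |z - Real.log A.det.re| ≤ ε n

end LogDetHardness

open LogDetHardness

namespace LogDetHardness

/-! ## Basic properties of the machine model -/

/-! Both parts follow from one construction, with 1-sparse matrices, condition number at most 2 and
constant accuracy 1/4.

Let `V` be a probabilistic machine using `m` random bits on input `x`, and put δ = 2^-(m+1).
`countingMatrix` is diagonal of size 2^n; its entry at index `i` is 1 - δ if `V` accepts with the
first `m` bits of `i` as coins, and 1 otherwise. Hence log det = N log(1 - δ), where N counts the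
accepting indices. The remaining index bits are padding: they keep the accepted fraction fixed while
multiplying N. With n = m + 2 + K and K ≥ m + 1, half of the indices contribute about -2^K to the
log-determinant. In the yes case the second-order term of the logarithm pushes the value below -2^K
- 1/2; in the no case at least one coin string is missing from half, and the value stays above -2^K
+ 1. An estimate with error 1/4 is therefore on the correct side of -2^K (`estimate_decides`). This
threshold is a power of two, so comparing a binary number with it only needs a sign bit and a search
for a high digit.

The padding also makes a single `τ` serve all problems of the class: `K` includes the running time
of `V`, so calling `V` costs at most `n` steps, and everything else an access program does is
bounded by a polynomial that does not depend on `V` (`exists_access_programs`). This gives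
PP-hardness (`exists_isHard_PP`).

BQP-hardness then follows from `BQP_subset_PP`. The amplitude of a circuit is a sum over paths, each
Hadamard gate choosing a bit. Two independent random paths, the second starting with the inverse of
the phase of the first, produce the squared modulus of the amplitude on average. Fair coins cannot
realize the weight cos(π/4), so the verifier uses only a sign on eight phases. Its Fourier expansion
yields the acceptance probability plus an error from the Galois conjugate √2 ↦ -√2, and that error
is controlled because the conjugate circuit is also unitary. A correction of probability 2^-h, with
h Hadamard gates, moves the cut to exactly 1/2.

The rest realizes these functions in the machine model. `ST` describes polynomial-time
transformations of finitely many registers, `Cmd` is a loop language whose syntax guarantees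
polynomial time (`Cmd.st`), and `ST.call` provides subroutines. -/

theorem eval_mono (q : Polynomial ℕ) {a b : ℕ} (h : a ≤ b) : q.eval a ≤ q.eval b := by
  rw [Polynomial.eval_eq_sum, Polynomial.eval_eq_sum]
  exact Finset.sum_le_sum fun i _ => Nat.mul_le_mul_left _ (Nat.pow_le_pow_left h _)

/-- Needed because correctness of an estimate quantifies over every matrix that the programs
describe; determinism forces these matrices to agree. -/
theorem Exec.det {P : Prog} {σ σ₁ σ₂ : Store} {t₁ t₂ : ℕ} (h₁ : Exec P σ σ₁ t₁)
    (h₂ : Exec P σ σ₂ t₂) : σ₁ = σ₂ := by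
  induction h₁ generalizing σ₂ t₂ with
  | skip => cases h₂; rfl
  | push => cases h₂; rfl
  | pop => cases h₂; rfl
  | seq _ _ ih ih' =>
    cases h₂ with
    | seq k k' => cases ih k; exact ih' k'
  | branchNil e _ ih => cases h₂ <;> first | exact ih ‹_› | simp_all
  | branchFalse e _ ih => cases h₂ <;> first | exact ih ‹_› | simp_all
  | branchTrue e _ ih => cases h₂ <;> first | exact ih ‹_› | simp_all
  | loopNil e => cases h₂ <;> simp_all
  | loopCons e _ _ ih ih' =>
    cases h₂ with
    | loopNil => contradiction
    | loopCons _ k k' => cases ih k; exact ih' k'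

/-- All registers that occur in the program are smaller than this number. -/
def Prog.bound : Prog → ℕ
  | Prog.skip => 0
  | Prog.push r _ => r + 1
  | Prog.pop r => r + 1
  | Prog.seq p q => max p.bound q.bound
  | Prog.branch r p q q' => max (r + 1) (max p.bound (max q.bound q'.bound))
  | Prog.loop r p => max (r + 1) p.bound

/-- A program names finitely many registers, so a caller has only finitely many to clean up after
it. -/
theorem Exec.eq_of_bound_le {P : Prog} {σ σ' : Store} {t : ℕ} (h : Exec P σ σ' t) {r : ℕ}
    (hr : P.bound ≤ r) : σ' r = σ r := by
  induction h with
  | skip => rfl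
  | push r' => simp only [Prog.bound] at hr; rw [Function.update_of_ne (by omega)]
  | pop r' => simp only [Prog.bound] at hr; rw [Function.update_of_ne (by omega)]
  | seq _ _ ih ih' => simp only [Prog.bound] at hr; rw [ih' (by omega), ih (by omega)]
  | branchNil _ _ ih => simp only [Prog.bound] at hr; exact ih (by omega)
  | branchFalse _ _ ih => simp only [Prog.bound] at hr; exact ih (by omega)
  | branchTrue _ _ ih => simp only [Prog.bound] at hr; exact ih (by omega)
  | loopNil => rfl
  | loopCons _ _ _ ih ih' =>
    rw [ih' hr]
    simp only [Prog.bound] at hr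
    exact ih (by omega)

theorem Exec.length_le {P : Prog} {σ σ' : Store} {t : ℕ} (h : Exec P σ σ' t) (r : ℕ) :
    (σ' r).length ≤ (σ r).length + t := by
  induction h with
  | skip => omega
  | push r' => by_cases e : r = r' <;> simp [Function.update, e]
  | pop r' =>
    by_cases e : r = r'
    · subst e; simp; omega
    · simp [Function.update, e]
  | seq => omega
  | branchNil => omega
  | branchFalse => omega
  | branchTrue => omega
  | loopNil => omega
  | loopCons => omega

theorem sum_update_le (σ : Store) (r k c : ℕ) (v : List Bool) (hv : v.length ≤ (σ r).length + c) :
    ∑ i ∈ Finset.range k, (Function.update σ r v i).length ≤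
      ∑ i ∈ Finset.range k, (σ i).length + c := by
  calc _ ≤ ∑ i ∈ Finset.range k, ((σ i).length + if i = r then c else 0) := by
        refine Finset.sum_le_sum fun i _ => ?_
        by_cases e : i = r
        · subst e; simpa using hv
        · simp [Function.update, e]
    _ ≤ _ := by
        rw [Finset.sum_add_distrib, Finset.sum_ite_eq']
        split_ifs <;> omega

/-- One step adds at most one bit in total. Running time thus bounds output size, which is what lets
polynomial bounds compose. -/
theorem Exec.sum_length_le {P : Prog} {σ σ' : Store} {t : ℕ} (h : Exec P σ σ' t) (k : ℕ) :
    ∑ i ∈ Finset.range k, (σ' i).length ≤ ∑ i ∈ Finset.range k, (σ i).length + t := by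
  induction h with
  | skip => omega
  | push r' b σ => exact sum_update_le _ _ _ _ _ (by simp)
  | pop r' σ =>
    exact (sum_update_le _ _ _ 0 _ (by simp)).trans (by omega)
  | seq => omega
  | branchNil => omega
  | branchFalse => omega
  | branchTrue => omega
  | loopNil => omega
  | loopCons => omega

/-- Renaming of register `r` to `r + c`. -/
def Prog.shift (c : ℕ) : Prog → Prog
  | Prog.skip => Prog.skip
  | Prog.push r b => Prog.push (r + c) b
  | Prog.pop r => Prog.pop (r + c)
  | Prog.seq p q => Prog.seq (p.shift c) (q.shift c)
  | Prog.branch r p q q' => Prog.branch (r + c) (p.shift c) (q.shift c) (q'.shift c)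
  | Prog.loop r p => Prog.loop (r + c) (p.shift c)

/-- The store with `τ` in the first `c` registers, followed by `σ`. -/
def glue (c : ℕ) (τ σ : Store) : Store := fun r => if r < c then τ r else σ (r - c)

@[simp] theorem glue_add (c : ℕ) (τ σ : Store) (r : ℕ) : glue c τ σ (r + c) = σ r := by
  simp [glue]

theorem glue_update (c : ℕ) (τ σ : Store) (r : ℕ) (v : List Bool) :
    Function.update (glue c τ σ) (r + c) v = glue c τ (Function.update σ r v) := by
  funext i
  by_cases e : i = r + c
  · subst e; simp
  · rw [Function.update_of_ne e]
    unfold glue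
    split_ifs with h
    · rfl
    · rw [Function.update_of_ne (by omega)]

/-- Moves a subroutine to registers `c` and above; the caller's data `τ` below stay untouched. -/
theorem Exec.shift {P : Prog} {σ σ' : Store} {t : ℕ} (h : Exec P σ σ' t) (c : ℕ) (τ : Store) :
    Exec (P.shift c) (glue c τ σ) (glue c τ σ') t := by
  induction h with
  | skip => exact .skip _
  | push r b σ =>
    have := Exec.push (r + c) b (glue c τ σ)
    rwa [glue_update, glue_add] at this
  | pop r σ =>
    have := Exec.pop (r + c) (glue c τ σ)
    rwa [glue_update, glue_add] at this
  | seq _ _ ih ih' => exact .seq ih ih'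
  | branchNil e _ ih => exact .branchNil (by simpa using e) ih
  | branchFalse e _ ih => exact .branchFalse (by simpa using e) ih
  | branchTrue e _ ih => exact .branchTrue (by simpa using e) ih
  | loopNil e => exact .loopNil (by simpa using e)
  | loopCons e _ _ ih ih' => exact .loopCons (by simpa using e) ih ih'

/-! ### The code of programs is a prefix code -/

theorem unary_append_inj {a b : ℕ} {u v : List Bool} (h : unary a ++ u = unary b ++ v) :
    a = b ∧ u = v := by
  induction a generalizing b with
  | zero => cases b <;> simp_all [unary, List.replicate_succ]
  | succ a ih =>
    cases b with
    | zero => simp_all [unary, List.replicate_succ]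
    | succ b =>
      have := @ih b (by simpa [unary, List.replicate_succ] using h)
      simpa using this

/-- Makes the concatenation of dimension and program codes in an instance uniquely readable. -/
theorem Prog.encode_append_inj {P Q : Prog} {u v : List Bool}
    (h : P.encode ++ u = Q.encode ++ v) : P = Q ∧ u = v := by
  induction P generalizing Q u v with
  | skip => cases Q <;> simp_all [Prog.encode]
  | push r b =>
    cases Q <;> simp [Prog.encode, List.append_assoc] at h ⊢
    obtain ⟨rfl, h⟩ := unary_append_inj h
    simpa using h
  | pop r =>
    cases Q <;> simp [Prog.encode, List.append_assoc] at h ⊢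
    exact unary_append_inj h
  | seq p q ih ih' =>
    cases Q <;> simp [Prog.encode, List.append_assoc] at h ⊢
    obtain ⟨rfl, h⟩ := ih h
    simpa using ih' (by simpa using h)
  | branch r p q q' ih ih' ih'' =>
    cases Q <;> simp [Prog.encode, List.append_assoc] at h ⊢
    obtain ⟨rfl, h⟩ := unary_append_inj h
    obtain ⟨rfl, h⟩ := ih (by simpa using h)
    obtain ⟨rfl, h⟩ := ih' (by simpa using h)
    simpa using ih'' (by simpa using h)
  | loop r p ih =>
    cases Q <;> simp [Prog.encode, List.append_assoc] at h ⊢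
    obtain ⟨rfl, h⟩ := unary_append_inj h
    simpa using ih (by simpa using h)

/-! ## Polynomial-time transformations of finitely many registers -/

/-- The contents of the first registers. -/
abbrev Regs := List (List Bool)

/-- The total number of bits. -/
def size (l : Regs) : ℕ := (l.map List.length).sum

theorem inputs_set {l : Regs} {r : ℕ} (h : r < l.length) (v : List Bool) :
    Function.update (inputs l) r v = inputs (l.set r v) := by
  funext i
  by_cases e : i = r
  · subst e; simp [inputs, h]
  · simp [inputs, Function.update_of_ne e, List.getElem?_set_ne (Ne.symm e)]

theorem inputs_append_replicate (l : Regs) (c : ℕ) :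
    inputs (l ++ List.replicate c []) = inputs l := by
  funext i
  simp only [inputs, List.getD_eq_getElem?_getD, List.getElem?_append, List.getElem?_replicate]
  split_ifs with h h' <;> simp_all

theorem inputs_append (p l : Regs) : inputs (p ++ l) = glue p.length (inputs p) (inputs l) := by
  funext i
  simp only [inputs, glue, List.getD_eq_getElem?_getD, List.getElem?_append]
  split_ifs <;> rfl

theorem size_eq_sum (l : Regs) :
    size l = ∑ i ∈ Finset.range l.length, (inputs l i).length := by
  induction l using List.reverseRecOn with
  | nil => simp [size]
  | append_singleton l a ih =>
    rw [List.length_append, List.length_singleton, Finset.sum_range_succ]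
    have : ∑ i ∈ Finset.range l.length, (inputs (l ++ [a]) i).length = size l := by
      rw [ih]
      refine Finset.sum_congr rfl fun i hi => ?_
      simp only [Finset.mem_range] at hi
      simp [inputs, List.getElem?_append, hi]
    rw [this]
    simp [size, inputs]

@[simp] theorem size_nil : size [] = 0 := rfl
@[simp] theorem size_cons (a : List Bool) (l : Regs) : size (a :: l) = a.length + size l := by
  simp [size]
@[simp] theorem size_append (l l' : Regs) : size (l ++ l') = size l + size l' := by
  simp [size]
@[simp] theorem size_replicate (c : ℕ) : size (List.replicate c []) = 0 := by
  simp [size]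

theorem size_set {l : Regs} {r : ℕ} (h : r < l.length) (v : List Bool) :
    size (l.set r v) + (l.getD r []).length = size l + v.length := by
  induction l generalizing r with
  | nil => simp at h
  | cons a l ih =>
    cases r with
    | zero => simp; omega
    | succ r =>
      have := @ih r (by simpa using h)
      simp at this ⊢; omega

theorem getD_length_le_size (l : Regs) (r : ℕ) : (l.getD r []).length ≤ size l := by
  induction l generalizing r with
  | nil => simp
  | cons a l ih =>
    cases r with
    | zero => simp
    | succ r => have := ih r; simp at this ⊢; omega

/-- Started with the register contents `l`, the program halts within `T` steps with the register
contents `l'`. -/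
def Runs (P : Prog) (l l' : Regs) (T : ℕ) : Prop := ∃ t ≤ T, Exec P (inputs l) (inputs l') t

theorem Runs.mono {P : Prog} {l l' : Regs} {T T' : ℕ} (h : Runs P l l' T) (hT : T ≤ T') :
    Runs P l l' T' := by
  obtain ⟨t, ht, h⟩ := h
  exact ⟨t, ht.trans hT, h⟩

theorem Runs.seq {P Q : Prog} {l l' l'' : Regs} {T T' : ℕ} (h : Runs P l l' T)
    (h' : Runs Q l' l'' T') : Runs (.seq P Q) l l'' (T + T') := by
  obtain ⟨t, ht, h⟩ := h
  obtain ⟨t', ht', h'⟩ := h'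
  exact ⟨t + t', by omega, .seq h h'⟩

theorem Runs.size_le {P : Prog} {l l' : Regs} {T : ℕ} (h : Runs P l l' T)
    (hl : l'.length = l.length) : size l' ≤ size l + T := by
  obtain ⟨t, ht, h⟩ := h
  have := h.sum_length_le l.length
  rw [size_eq_sum, size_eq_sum, hl]
  omega

theorem Runs.shift {P : Prog} {l l' : Regs} {T : ℕ} (h : Runs P l l' T) (p : Regs) :
    Runs (P.shift p.length) (p ++ l) (p ++ l') T := by
  obtain ⟨t, ht, h⟩ := h
  exact ⟨t, ht, by simpa only [inputs_append] using h.shift p.length (inputs p)⟩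

/-- `F` is a polynomial-time computable transformation of `k` registers. -/
def ST (k : ℕ) (F : Regs → Regs) : Prop :=
  (∀ l, l.length = k → (F l).length = k) ∧
  ∃ (P : Prog) (q : Polynomial ℕ), ∀ l, l.length = k → Runs P l (F l) (q.eval (size l))

theorem ST.id (k : ℕ) : ST k fun l => l :=
  ⟨fun _ h => h, .skip, 1, fun l _ => ⟨1, by simp, .skip _⟩⟩

theorem ST.push {k r : ℕ} (hr : r < k) (b : Bool) : ST k fun l => l.set r (b :: l.getD r []) :=
  ⟨fun l h => by simpa using h, .push r b, 1, fun l h => ⟨1, by simp, by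
    rw [← inputs_set (h ▸ hr)]; exact .push r b _⟩⟩

theorem ST.pop {k r : ℕ} (hr : r < k) : ST k fun l => l.set r (l.getD r []).tail :=
  ⟨fun l h => by simpa using h, .pop r, 1, fun l h => ⟨1, by simp, by
    rw [← inputs_set (h ▸ hr)]; exact .pop r _⟩⟩

/-- The second program sees an input no larger than the original size plus the running time of the
first, hence the inner polynomial `.X + p`. -/
theorem ST.comp {k : ℕ} {F G : Regs → Regs} (hF : ST k F) (hG : ST k G) :
    ST k fun l => G (F l) := by
  obtain ⟨hF1, P, p, hP⟩ := hF
  obtain ⟨hG1, Q, q, hQ⟩ := hG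
  refine ⟨fun l h => hG1 _ (hF1 _ h), .seq P Q, p + q.comp (.X + p), fun l h => ?_⟩
  have h1 := hP l h
  refine (h1.seq (hQ _ (hF1 _ h))).mono ?_
  simp only [Polynomial.eval_add, Polynomial.eval_comp, Polynomial.eval_X]
  gcongr
  exact eval_mono _ (h1.size_le ((hF1 _ h).trans h.symm))

/-- Case distinction on the top of a register. -/
def sel {α : Type*} (w : List Bool) (a b c : α) : α :=
  match w with
  | [] => a
  | false :: _ => b
  | true :: _ => c

theorem ST.branch {k r : ℕ} {F G H : Regs → Regs} (hF : ST k F) (hG : ST k G)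
    (hH : ST k H) : ST k fun l => sel (l.getD r []) (F l) (G l) (H l) := by
  obtain ⟨hF1, P, p, hP⟩ := hF
  obtain ⟨hG1, Q, q, hQ⟩ := hG
  obtain ⟨hH1, R, u, hR⟩ := hH
  refine ⟨fun l h => ?_, .branch r P Q R, p + q + u + 1, fun l h => ?_⟩
  · dsimp only
    rcases l.getD r [] with _ | ⟨_ | _, _⟩
    exacts [hF1 l h, hG1 l h, hH1 l h]
  · simp only [Polynomial.eval_add, Polynomial.eval_one]
    have e : inputs l r = l.getD r [] := rfl
    rcases h' : l.getD r [] with _ | ⟨_ | _, w⟩ <;> rw [h'] at e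
    · obtain ⟨t, ht, h⟩ := hP l h
      exact ⟨t + 1, by omega, .branchNil e h⟩
    · obtain ⟨t, ht, h⟩ := hQ l h
      exact ⟨t + 1, by omega, .branchFalse (by rw [e]; rfl) h⟩
    · obtain ⟨t, ht, h⟩ := hR l h
      exact ⟨t + 1, by omega, .branchTrue (by rw [e]; rfl) h⟩

/-- Run `p` or `q` for each bit of register `r`, removing that bit. -/
def forBits (r : ℕ) (p q : Prog) : Prog :=
  .loop r (.branch r .skip (.seq (.pop r) p) (.seq (.pop r) q))

theorem set_getD_self (s : Regs) (r : ℕ) : s.set r (s.getD r []) = s := by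
  apply List.ext_getElem?
  intro i
  by_cases e : i = r
  · subst e
    by_cases h : i < s.length
    · simp [h]
    · simp [h]
  · rw [List.getElem?_set_ne (Ne.symm e)]

/-- While a body runs, register `r` still holds the unread bits. By `hF` the body neither depends on
them nor alters them. `M` bounds the intermediate stores without these bits and `W` bounds the bits
themselves; the 3 pays for loop test, branch test and pop. -/
theorem Runs.forBits {k r : ℕ} (hr : r < k) {F : Bool → Regs → Regs} {P : Bool → Prog}
    (hF1 : ∀ b l, l.length = k → (F b l).length = k)
    (hF : ∀ b l w, l.length = k → F b (l.set r w) = (F b l).set r w)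
    {T M W : ℕ} (hP : ∀ b l, l.length = k → size l ≤ M + W → Runs (P b) l (F b l) T)
    (w : List Bool) (hw : w.length ≤ W) (s : Regs) (hs : s.length = k) (hsr : s.getD r [] = [])
    (hM : ∀ v, v <+: w → size (v.foldl (fun s b => F b s) s) ≤ M) :
    Runs (forBits r (P false) (P true)) (s.set r w) (w.foldl (fun s b => F b s) s)
      ((T + 3) * w.length + 1) := by
  induction w generalizing s with
  | nil =>
    have : s.set r [] = s := by conv_lhs => rw [← hsr, set_getD_self]
    rw [this]
    exact ⟨1, by simp, .loopNil hsr⟩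
  | cons b w ih =>
    have hr' : r < s.length := hs ▸ hr
    have hFr : (F b s).getD r [] = [] := by
      have := hF b s [] hs
      rw [← hsr, set_getD_self] at this
      rw [this, hsr]
      simp [hF1 b s hs, hr]
    obtain ⟨t', ht', h'⟩ := ih (by simp at hw; omega) (F b s) (hF1 b s hs) hFr
      fun v hv => hM (b :: v) (by simpa using hv)
    have hsz : size (s.set r w) ≤ M + W := by
      have := size_set hr' w
      rw [hsr] at this
      have := hM [] (by simp)
      simp at this hw
      simp at *
      omega
    obtain ⟨t, ht, h⟩ := hP b (s.set r w) (by simpa using hs) hsz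
    rw [hF b s w hs] at h
    have e : inputs (s.set r (b :: w)) r = b :: w := by simp [inputs, hr']
    have hpop : Exec (.pop r) (inputs (s.set r (b :: w))) (inputs (s.set r w)) 1 := by
      have := Exec.pop r (inputs (s.set r (b :: w)))
      rw [e, inputs_set (by simpa using hr'), List.set_set] at this
      exact this
    refine ⟨(1 + t + 1) + t' + 1, ?_, .loopCons (by rw [e]; simp) ?_ h'⟩
    · simp only [List.length_cons]
      nlinarith
    · cases b
      · exact .branchFalse (by rw [e]; rfl) (.seq hpop h)
      · exact .branchTrue (by rw [e]; rfl) (.seq hpop h)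

/-- Iterating a polynomial-time body can double the store each time, so a polynomial bound `B` on
all intermediate sizes is a hypothesis. -/
theorem ST.fold {k r : ℕ} (hr : r < k) {F : Bool → Regs → Regs} (h : ∀ b, ST k (F b))
    (hF : ∀ b l w, l.length = k → F b (l.set r w) = (F b l).set r w) (B : Polynomial ℕ)
    (hB : ∀ l, l.length = k → ∀ w, w <+: l.getD r [] →
      size (w.foldl (fun s b => F b s) (l.set r [])) ≤ B.eval (size l)) :
    ST k fun l => (l.getD r []).foldl (fun s b => F b s) (l.set r []) := by
  choose hF1 P q hP using h
  refine ⟨fun l hl => ?_, LogDetHardness.forBits r (P false) (P true),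
    ((q false + q true).comp (B + .X) + 3) * .X + 1, fun l hl => ?_⟩
  · have : ∀ (w : List Bool) (s : Regs), s.length = k →
        (w.foldl (fun s b => F b s) s).length = k := by
      intro w
      induction w with
      | nil => exact fun s hs => hs
      | cons b w ih => exact fun s hs => ih _ (hF1 b s hs)
    exact this _ _ (by simpa using hl)
  · have := Runs.forBits hr hF1 hF (P := P) (M := B.eval (size l)) (W := size l)
      (T := (q false + q true).eval (B.eval (size l) + size l))
      (fun b l' hl' hsz => (hP b l' hl').mono ?_) (l.getD r []) (getD_length_le_size _ _)
      (l.set r []) (by simpa using hl) (by simp [hl, hr]) (hB l hl)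
    · rw [List.set_set, set_getD_self] at this
      refine this.mono ?_
      simp only [Polynomial.eval_add, Polynomial.eval_mul, Polynomial.eval_comp,
        Polynomial.eval_X, Polynomial.eval_one, Polynomial.eval_ofNat]
      gcongr
      exact getD_length_le_size _ _
    · rw [Polynomial.eval_add]
      cases b
      · exact (eval_mono _ hsz).trans (Nat.le_add_right _ _)
      · exact (eval_mono _ hsz).trans (Nat.le_add_left _ _)

/-! ## A small language for register transformations -/

/-- Commands; `fold r a b` runs `a` or `b` for each bit of register `r`, which is emptied. -/
inductive Cmd : Type
  | skip : Cmd
  | push (r : ℕ) (b : Bool) : Cmd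
  | pop (r : ℕ) : Cmd
  | seq (a b : Cmd) : Cmd
  | branch (r : ℕ) (a b c : Cmd) : Cmd
  | fold (r : ℕ) (a b : Cmd) : Cmd

namespace Cmd

def eval : Cmd → Regs → Regs
  | skip, l => l
  | push r b, l => l.set r (b :: l.getD r [])
  | pop r, l => l.set r (l.getD r []).tail
  | seq a b, l => b.eval (a.eval l)
  | branch r a b c, l => sel (l.getD r []) (a.eval l) (b.eval l) (c.eval l)
  | fold r a b, l =>
      (l.getD r []).foldl (fun s x => cond x (b.eval s) (a.eval s)) (l.set r [])

/-- The command does not mention the register. -/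
def Avoids (i : ℕ) : Cmd → Prop
  | skip => True
  | push r _ => r ≠ i
  | pop r => r ≠ i
  | seq a b => a.Avoids i ∧ b.Avoids i
  | branch r a b c => r ≠ i ∧ a.Avoids i ∧ b.Avoids i ∧ c.Avoids i
  | fold r a b => r ≠ i ∧ a.Avoids i ∧ b.Avoids i

/-- A bound for the number of bits that a tame command adds. -/
def growth : Cmd → ℕ
  | skip => 0
  | push _ _ => 1
  | pop _ => 0
  | seq a b => a.growth + b.growth
  | branch _ a b c => max a.growth (max b.growth c.growth)
  | fold _ _ _ => 0

/-- The bodies of folds add at most one bit for each bit consumed. -/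
def Tame : Cmd → Prop
  | skip => True
  | push _ _ => True
  | pop _ => True
  | seq a b => a.Tame ∧ b.Tame
  | branch _ a b c => a.Tame ∧ b.Tame ∧ c.Tame
  | fold _ a b => a.Tame ∧ b.Tame ∧ a.growth ≤ 1 ∧ b.growth ≤ 1

/-- The command uses the first `k` registers only, and the bodies of folds are tame and do not
mention the register that drives the fold. -/
def Wf (k : ℕ) : Cmd → Prop
  | skip => True
  | push r _ => r < k
  | pop r => r < k
  | seq a b => a.Wf k ∧ b.Wf k
  | branch _ a b c => a.Wf k ∧ b.Wf k ∧ c.Wf k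
  | fold r a b => r < k ∧ a.Avoids r ∧ b.Avoids r ∧ a.Tame ∧ b.Tame ∧ a.Wf k ∧ b.Wf k

/-! ### Length, locality and size bounds for commands -/

theorem length_eval (c : Cmd) (l : Regs) : (c.eval l).length = l.length := by
  induction c generalizing l with
  | skip => rfl
  | push => simp [eval]
  | pop => simp [eval]
  | seq a b iha ihb => rw [eval, ihb, iha]
  | branch r a b c iha ihb ihc =>
    rw [eval]
    rcases l.getD r [] with _ | ⟨_ | _, _⟩
    exacts [iha l, ihb l, ihc l]
  | fold r a b iha ihb =>
    rw [eval]
    have : ∀ (w : List Bool) (s : Regs),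
        (w.foldl (fun s x => cond x (b.eval s) (a.eval s)) s).length = s.length := by
      intro w
      induction w with
      | nil => exact fun s => rfl
      | cons x w ih =>
        intro s
        rw [List.foldl_cons, ih]
        cases x
        exacts [iha s, ihb s]
    simpa using this _ (l.set r [])

theorem eval_set (c : Cmd) {i : ℕ} (h : c.Avoids i) (l : Regs) (w : List Bool) :
    c.eval (l.set i w) = (c.eval l).set i w := by
  induction c generalizing l with
  | skip => rfl
  | push r => simp only [Avoids] at h; simp [eval, List.set_comm _ _ h, List.getElem?_set_ne h.symm]
  | pop r => simp only [Avoids] at h; simp [eval, List.set_comm _ _ h, List.getElem?_set_ne h.symm]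
  | seq a b iha ihb => rw [eval, eval, iha h.1, ihb h.2]
  | branch r a b c iha ihb ihc =>
    obtain ⟨h, ha, hb, hc⟩ := h
    have e : (l.set i w).getD r [] = l.getD r [] := by simp [List.getElem?_set_ne h.symm]
    rw [eval, eval, e]
    rcases l.getD r [] with _ | ⟨_ | _, _⟩
    exacts [iha ha l, ihb hb l, ihc hc l]
  | fold r a b iha ihb =>
    obtain ⟨h, ha, hb⟩ := h
    have e : (l.set i w).getD r [] = l.getD r [] := by simp [List.getElem?_set_ne h.symm]
    rw [eval, eval, e, List.set_comm _ _ h.symm]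
    generalize l.set r [] = s
    induction l.getD r [] generalizing s with
    | nil => rfl
    | cons x v ih =>
      rw [List.foldl_cons, List.foldl_cons, ← ih]
      cases x
      exacts [by rw [cond_false, cond_false, iha ha s], by rw [cond_true, cond_true, ihb hb s]]

theorem size_foldl_le {k : ℕ} {F : Bool → Regs → Regs}
    (hF1 : ∀ b l, l.length = k → (F b l).length = k) {d : ℕ}
    (hF : ∀ b l, l.length = k → size (F b l) ≤ size l + d) (w : List Bool) (l : Regs)
    (hl : l.length = k) : size (w.foldl (fun s b => F b s) l) ≤ size l + d * w.length := by
  induction w generalizing l with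
  | nil => simp
  | cons b w ih =>
    have h1 := ih (F b l) (hF1 b l hl)
    have h2 := hF b l hl
    simp only [List.foldl_cons, List.length_cons]
    nlinarith

/-- A tame command adds a constant number of bits whatever the store. For a fold, the at most one
bit added per round is paid for by the bit consumed from the driving register. -/
theorem size_eval_le {k : ℕ} (c : Cmd) (h : c.Wf k) (ht : c.Tame) (l : Regs) (hl : l.length = k) :
    size (c.eval l) ≤ size l + c.growth := by
  induction c generalizing l with
  | skip => simp [eval]
  | push r b =>
    have := size_set (l := l) (r := r) (hl ▸ h) (b :: l.getD r [])
    simp only [eval, growth, List.length_cons] at *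
    omega
  | pop r =>
    have := size_set (l := l) (r := r) (hl ▸ h) (l.getD r []).tail
    simp only [eval, growth, List.length_tail] at *
    omega
  | seq a b iha ihb =>
    have h1 := iha h.1 ht.1 l hl
    have h2 := ihb h.2 ht.2 (a.eval l) ((length_eval _ _).trans hl)
    simp only [eval, growth] at *
    omega
  | branch r a b c iha ihb ihc =>
    have h1 := iha h.1 ht.1 l hl
    have h2 := ihb h.2.1 ht.2.1 l hl
    have h3 := ihc h.2.2 ht.2.2 l hl
    simp only [eval, growth]
    rcases l.getD r [] with _ | ⟨_ | _, _⟩ <;> simp only [sel] <;> omega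
  | fold r a b iha ihb =>
    obtain ⟨hr, _, _, _, _, ha, hb⟩ := h
    obtain ⟨ta, tb, ga, gb⟩ := ht
    have h1 := size_foldl_le (k := k) (F := fun x s => cond x (b.eval s) (a.eval s)) (d := 1)
      (by rintro (_ | _) s hs; exacts [(length_eval _ _).trans hs, (length_eval _ _).trans hs])
      (by
        rintro (_ | _) s hs
        exacts [(iha ha ta s hs).trans (by omega), (ihb hb tb s hs).trans (by omega)])
      (l.getD r []) (l.set r []) (by simpa using hl)
    have h2 := size_set (l := l) (r := r) (hl ▸ hr) []
    simp only [eval, growth, List.length_nil] at *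
    omega

/-- Each round of a fold adds at most a constant number of bits, so all intermediate stores are
linear in the input and `ST.fold` applies. -/
theorem st {k : ℕ} (c : Cmd) (h : c.Wf k) : ST k c.eval := by
  induction c with
  | skip => exact .id k
  | push r b => exact .push h b
  | pop r => exact .pop h
  | seq a b iha ihb => exact (iha h.1).comp (ihb h.2)
  | branch r a b c iha ihb ihc => exact .branch (iha h.1) (ihb h.2.1) (ihc h.2.2)
  | fold r a b iha ihb =>
    obtain ⟨hr, aa, ab, ta, tb, ha, hb⟩ := h
    refine ST.fold (F := fun x s => cond x (b.eval s) (a.eval s)) hr ?_ ?_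
      (.X + (a.growth + b.growth : ℕ) * .X) ?_
    · rintro (_ | _)
      exacts [iha ha, ihb hb]
    · rintro (_ | _) l w _
      exacts [eval_set a aa l w, eval_set b ab l w]
    · intro l hl w hw
      have h1 := size_foldl_le (k := k) (F := fun x s => cond x (b.eval s) (a.eval s))
        (d := a.growth + b.growth)
        (by rintro (_ | _) s hs; exacts [(length_eval _ _).trans hs, (length_eval _ _).trans hs])
        (by
          rintro (_ | _) s hs
          exacts [(size_eval_le a ha ta s hs).trans (by omega),
            (size_eval_le b hb tb s hs).trans (by omega)])
        w (l.set r []) (by simpa using hl)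
      have h2 := size_set (l := l) (r := r) (hl ▸ hr) []
      have h3 := hw.length_le.trans (getD_length_le_size l r)
      simp only [List.length_nil] at h2
      simp only [Polynomial.eval_add, Polynomial.eval_mul, Polynomial.eval_X,
        Polynomial.eval_natCast, Nat.cast_id]
      have h4 := Nat.mul_le_mul_left (a.growth + b.growth) h3
      omega

/-! ### Macros -/

/-- Push a list of bits on a register. -/
def pushL (r : ℕ) : List Bool → Cmd
  | [] => skip
  | b :: w => seq (pushL r w) (push r b)

/-- Move the bits of register `r` to register `s`, in reverse order. -/
def mv (r s : ℕ) : Cmd := fold r (push s false) (push s true)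

/-- Empty a register. -/
def clear (r : ℕ) : Cmd := fold r skip skip

/-- Append a copy of register `r` on top of register `s`, with the empty register `t` as auxiliary
space. -/
def copy (r t s : ℕ) : Cmd :=
  seq (mv r t) (fold t (seq (push r false) (push s false)) (seq (push r true) (push s true)))

/-- Empty the registers `c, …, c + n - 1`. -/
def clearFrom (c : ℕ) : ℕ → Cmd
  | 0 => skip
  | n + 1 => seq (clear c) (clearFrom (c + 1) n)

@[simp] theorem wf_pushL {k r : ℕ} {w : List Bool} (h : r < k) : (pushL r w).Wf k := by
  induction w <;> simp_all [pushL, Wf]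

@[simp] theorem tame_pushL {r : ℕ} {w : List Bool} : (pushL r w).Tame := by
  induction w <;> simp_all [pushL, Tame]

@[simp] theorem avoids_pushL {i r : ℕ} {w : List Bool} (h : r ≠ i) : (pushL r w).Avoids i := by
  induction w <;> simp_all [pushL, Avoids]

@[simp] theorem wf_mv {k r s : ℕ} (hr : r < k) (hs : s < k) (h : s ≠ r) : (mv r s).Wf k := by
  simp_all [mv, Wf, Avoids, Tame]

@[simp] theorem tame_mv {r s : ℕ} : (mv r s).Tame := by
  simp [mv, Tame, growth]

@[simp] theorem avoids_mv {i r s : ℕ} (hr : r ≠ i) (hs : s ≠ i) : (mv r s).Avoids i := by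
  simp_all [mv, Avoids]

@[simp] theorem wf_clear {k r : ℕ} (hr : r < k) : (clear r).Wf k := by
  simp_all [clear, Wf, Avoids, Tame]

@[simp] theorem wf_copy {k r t s : ℕ} (hr : r < k) (ht : t < k) (hs : s < k) (h : r ≠ t)
    (h' : s ≠ t) : (copy r t s).Wf k := by
  simp_all [copy, Wf, Avoids, Tame, h.symm]

theorem wf_clearFrom {k c n : ℕ} (h : c + n ≤ k) : (clearFrom c n).Wf k := by
  induction n generalizing c with
  | zero => trivial
  | succ n ih => exact ⟨wf_clear (by omega), ih (by omega)⟩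

/-! ### Effect of the macros -/

theorem eval_pushL {r : ℕ} {l : Regs} (h : r < l.length) (w : List Bool) :
    (pushL r w).eval l = l.set r (w ++ l.getD r []) := by
  induction w with
  | nil => simp only [pushL, eval, List.nil_append, set_getD_self]
  | cons b w ih => simp [pushL, eval, ih, h]

theorem foldl_push (s : ℕ) (w : List Bool) {l : Regs} (h : s < l.length) :
    w.foldl (fun l x => cond x ((push s true).eval l) ((push s false).eval l)) l =
      l.set s (w.reverse ++ l.getD s []) := by
  induction w generalizing l with
  | nil => simp only [List.foldl_nil, List.reverse_nil, List.nil_append, set_getD_self]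
  | cons b w ih =>
    rw [List.foldl_cons, ih (by cases b <;> simpa [eval] using h)]
    cases b <;> simp [eval, h]

theorem eval_mv {r s : ℕ} {l : Regs} (h : s < l.length) (hrs : r ≠ s) :
    (mv r s).eval l = (l.set r []).set s ((l.getD r []).reverse ++ l.getD s []) := by
  rw [mv, eval, foldl_push s _ (by simpa using h)]
  simp [List.getElem?_set_ne hrs]

theorem eval_clear (r : ℕ) (l : Regs) : (clear r).eval l = l.set r [] := by
  rw [clear, eval]
  generalize l.set r [] = s
  induction l.getD r [] generalizing s with
  | nil => rfl
  | cons x w ih => rw [List.foldl_cons]; cases x <;> exact ih s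

theorem foldl_push_two (r s : ℕ) (hrs : r ≠ s) (w : List Bool) {l : Regs} (hr : r < l.length)
    (hs : s < l.length) :
    w.foldl (fun l x => cond x ((seq (push r true) (push s true)).eval l)
      ((seq (push r false) (push s false)).eval l)) l =
      (l.set r (w.reverse ++ l.getD r [])).set s (w.reverse ++ l.getD s []) := by
  induction w generalizing l with
  | nil =>
    simp only [List.foldl_nil, List.reverse_nil, List.nil_append, set_getD_self]
  | cons b w ih =>
    rw [List.foldl_cons, ih (by cases b <;> simpa [eval] using hr)
      (by cases b <;> simpa [eval] using hs)]
    cases b <;>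
      simp [eval, hr, hs, hrs, hrs.symm, List.set_comm _ _ hrs.symm]

theorem eval_copy {r t s : ℕ} {l : Regs} (hr : r < l.length) (ht : t < l.length)
    (hs : s < l.length) (hrt : r ≠ t) (hst : s ≠ t) (hrs : r ≠ s) (h : l.getD t [] = []) :
    (copy r t s).eval l = l.set s (l.getD r [] ++ l.getD s []) := by
  rw [copy, eval, eval_mv ht hrt, h, List.append_nil, eval,
    foldl_push_two r s hrs _ (by simpa using hr) (by simpa using hs)]
  have : l.set t [] = l := by conv_lhs => rw [← h, set_getD_self]
  have hg : ∀ (l : Regs) (i j : ℕ) (v : List Bool), i ≠ j → (l.set i v).getD j [] = l.getD j [] :=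
    fun l i j v h => by simp [List.getElem?_set_ne h]
  have hg' : ∀ (l : Regs) (i : ℕ) (v : List Bool), i < l.length → (l.set i v).getD i [] = v :=
    fun l i v h => by simp [h]
  rw [hg' _ _ _ (by simpa using ht), List.reverse_reverse, List.set_set]
  rw [hg _ _ _ _ hrt.symm, hg' _ _ _ hr, hg _ _ _ _ hst.symm, hg _ _ _ _ hrs, List.append_nil]
  rw [List.set_comm _ _ hrt, this, List.set_set, set_getD_self]

theorem eval_clearFrom (p l : Regs) :
    (clearFrom p.length l.length).eval (p ++ l) = p ++ List.replicate l.length [] := by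
  induction l generalizing p with
  | nil => rfl
  | cons a l ih =>
    have := ih (p ++ [[]])
    simp only [List.length_append, List.length_singleton, List.append_assoc] at this
    simpa [clearFrom, eval, eval_clear, List.replicate_succ] using this

end Cmd

/-! ## Calls of polynomial-time functions -/

theorem ST.polyTime {j k : ℕ} (hjk : j ≤ k) {F : Regs → Regs} (h : ST k F)
    {f : (Fin j → List Bool) → List Bool}
    (hf : ∀ args, (F (List.ofFn args ++ List.replicate (k - j) [])).getD 0 [] = f args) :
    PolyTime f := by
  obtain ⟨-, P, q, hP⟩ := h
  refine ⟨P, q, fun args => ?_⟩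
  obtain ⟨t, ht, h⟩ := hP (List.ofFn args ++ List.replicate (k - j) []) (by simp; omega)
  rw [inputs_append_replicate] at h
  refine ⟨_, t, h, ?_, hf args⟩
  have : size (List.ofFn args) = ∑ i, (args i).length := by
    simp [size, List.map_ofFn, List.sum_ofFn]
  simpa [this] using ht

theorem ofFn_take_succ {j : ℕ} (g : Fin j → List Bool) {i : ℕ} (h : i < j) :
    (List.ofFn g).take (i + 1) = (List.ofFn g).take i ++ [g ⟨i, h⟩] := by
  rw [List.take_add_one]
  simp [h]

/-- Copy the registers `ρ 0, …, ρ (j - 1)` behind the first `k` registers. -/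
theorem exists_copy_args {j k M : ℕ} (ρ : Fin j → ℕ) (hρ : ∀ i, ρ i < k) (hM : j + 1 ≤ M) (i : ℕ)
    (hi : i ≤ j) : ∃ F, ST (k + M) F ∧ ∀ l : Regs, l.length = k →
      F (l ++ List.replicate M []) =
        l ++ ((List.ofFn fun i => l.getD (ρ i) []).take i ++ List.replicate (M - i) []) := by
  induction i with
  | zero => exact ⟨_, .id _, fun l _ => by simp⟩
  | succ i ih =>
    obtain ⟨F, hF, h⟩ := ih (by omega)
    have hri := hρ ⟨i, by omega⟩
    -- The last register, `k + M - 1`, is the auxiliary space of `copy`; `hM` keeps it apart from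
    -- the copied arguments.
    refine ⟨_, hF.comp ((Cmd.copy (ρ ⟨i, by omega⟩) (k + M - 1) (k + i)).st
      (Cmd.wf_copy (by omega) (by omega) (by omega) (by omega) (by omega))), fun l hl => ?_⟩
    rw [h l hl]
    set a := (List.ofFn fun i => l.getD (ρ i) []).take i with ha
    have hal : a.length = i := by simp [ha]; omega
    rw [Cmd.eval_copy (by simp; omega) (by simp; omega) (by simp; omega) (by omega) (by omega)
      (by omega) (by simp [List.getElem?_append, List.getElem?_replicate, hl, hal]
                     rw [if_neg (by omega), if_neg (by omega)]; split_ifs <;> rfl)]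
    rw [ofFn_take_succ _ (by omega), ← ha]
    have e1 : (l ++ (a ++ List.replicate (M - i) [])).getD (ρ ⟨i, by omega⟩) [] =
        l.getD (ρ ⟨i, by omega⟩) [] := by
      simp [List.getElem?_append, hl, hri]
    have e2 : (l ++ (a ++ List.replicate (M - i) [])).getD (k + i) [] = [] := by
      simp [List.getElem?_append, List.getElem?_replicate, hl, hal]
      split_ifs <;> rfl
    rw [e1, e2, List.append_nil, List.set_append_right _ _ (by omega),
      List.set_append_right _ _ (by omega)]
    have e3 : M - i = (M - (i + 1)) + 1 := by omega
    rw [e3, List.replicate_succ, show k + i - l.length - a.length = 0 by omega, List.set_cons_zero]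
    simp

/-- Subroutine call: copy the arguments behind the caller's registers, run the shifted program
there, erase what it leaves, and bring the value back. -/
theorem ST.call {j k : ℕ} {f : (Fin j → List Bool) → List Bool} (hf : PolyTime f) (ρ : Fin j → ℕ)
    (hρ : ∀ i, ρ i < k) {r : ℕ} (hr : r < k) :
    ST k fun l => l.set r (f fun i => l.getD (ρ i) []) := by
  obtain ⟨P, q, hP⟩ := hf
  -- `N + 1` registers contain everything the subroutine may touch; one more provides for the
  -- copying.
  obtain ⟨N, hN1, hN2⟩ : ∃ N, j ≤ N ∧ P.bound ≤ N + 1 := ⟨max j P.bound, by omega, by omega⟩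
  obtain ⟨F, ⟨hF1, PF, qF, hF⟩, hFe⟩ := exists_copy_args (M := N + 2) ρ hρ (by omega) j le_rfl
  -- The value is moved twice because `mv` reverses.
  let C := Cmd.seq (.clear r) (.seq (.clearFrom (k + 1) (N + 1))
    (.seq (.mv k (k + 1)) (.mv (k + 1) r)))
  have hC : C.Wf (k + (N + 2)) := ⟨Cmd.wf_clear (by omega), Cmd.wf_clearFrom (by omega),
    Cmd.wf_mv (by omega) (by omega) (by omega), Cmd.wf_mv (by omega) (by omega) (by omega)⟩
  obtain ⟨-, PC, qC, hPC⟩ := C.st hC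
  refine ⟨fun l hl => by simpa using hl, .seq PF (.seq (P.shift k) PC),
    qF + (q.comp (j * .X) + qC.comp (.X + qF + q.comp (j * .X))), fun l hl => ?_⟩
  set args : Fin j → List Bool := fun i => l.getD (ρ i) [] with hargs
  have h1 := hF (l ++ List.replicate (N + 2) []) (by simp [hl])
  have hs1 := h1.size_le (by rw [hF1 _ (by simp [hl])]; simp [hl])
  rw [hFe l hl, List.take_of_length_le (by simp)] at h1 hs1
  rw [← hargs] at h1 hs1
  obtain ⟨σ, t, hex, ht, hσ⟩ := hP args
  have hargsz : ∑ i, (args i).length ≤ j * size l := by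
    calc _ ≤ ∑ i : Fin j, size l := Finset.sum_le_sum fun i _ => getD_length_le_size _ _
      _ = _ := by simp
  have hσe : σ = inputs (f args :: List.ofFn fun i : Fin (N + 1) => σ (i + 1)) := by
    funext i
    rcases i with _ | i
    · simpa [inputs] using hσ
    · by_cases hi : i < N + 1
      · simp only [inputs, List.getD_eq_getElem?_getD, List.getElem?_cons_succ, List.getElem?_ofFn,
          dif_pos hi, Option.getD_some]
      · rw [hex.eq_of_bound_le (by omega)]
        have : ¬ i + 1 < j := by omega
        simp [inputs, hi, this]
  set l2 := List.ofFn fun i : Fin (N + 1) => σ (i + 1) with hl2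
  have hl2' : l2.length = N + 1 := by simp [hl2]
  have h2 : Runs P (List.ofFn args ++ List.replicate (N + 2 - j) []) (f args :: l2)
      (q.eval (j * size l)) := by
    refine ⟨t, ht.trans (eval_mono _ hargsz), ?_⟩
    rw [inputs_append_replicate, ← hσe]
    exact hex
  have h2' := h2.shift l
  have hs2 := h2'.size_le (by simp [hl2']; omega)
  rw [hl] at h2'
  have h3 := hPC (l ++ f args :: l2) (by simp [hl, hl2'])
  have e : C.eval (l ++ f args :: l2) = l.set r (f args) ++ List.replicate (N + 2) [] := by
    have e1 := Cmd.eval_clearFrom (l.set r [] ++ [f args]) l2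
    simp only [List.length_append, List.length_set, hl, List.length_singleton, hl2',
      List.append_assoc, List.singleton_append] at e1
    have hg : l.set r [] ++ f args :: List.replicate (N + 1) [] =
      (l.set r [] ++ f args :: [] :: List.replicate N []) := by rw [List.replicate_succ]
    simp only [C, Cmd.eval, Cmd.eval_clear]
    rw [List.set_append_left _ _ (by omega), e1, hg]
    have e2 := Cmd.eval_mv (r := k) (s := k + 1) (l := l.set r [] ++ f args :: [] :: List.replicate N [])
      (by simp [hl]) (by omega)
    have e3 : (Cmd.mv k (k + 1)).eval (l.set r [] ++ f args :: [] :: List.replicate N []) =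
        l.set r [] ++ [] :: (f args).reverse :: List.replicate N [] := by
      rw [e2, List.set_append_right _ _ (by simp [hl]), List.set_append_right _ _ (by simp [hl])]
      simp [hl]
    rw [e3, Cmd.eval_mv (by simp [hl]; omega) (by omega),
      List.set_append_right _ _ (by simp [hl]), List.set_append_left _ _ (by simp [hl, hr])]
    simp [List.getElem?_append, hl, hr, List.replicate_succ]
  rw [e] at h3
  have h4 := h1.seq (h2'.seq h3)
  obtain ⟨t', ht', h4⟩ := h4
  rw [inputs_append_replicate, inputs_append_replicate] at h4
  refine ⟨t', ht'.trans ?_, h4⟩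
  simp only [Polynomial.eval_add, Polynomial.eval_comp, Polynomial.eval_mul, Polynomial.eval_X,
    Polynomial.eval_natCast, Nat.cast_id, size_append, size_replicate, Nat.add_zero] at *
  have := eval_mono qC (a := size l + size (f args :: l2))
    (b := size l + qF.eval (size l) + q.eval (j * size l)) (by omega)
  omega

/-! ## Polynomials in unary -/

/-- The number `n` in unary. -/
abbrev ones (n : ℕ) : List Bool := List.replicate n true

/-- Prepend the register `1` to register `2`. -/
def appendCmd : Cmd := .seq (.clear 3) (.copy 1 3 2)

theorem eval_appendCmd (a b c d : List Bool) :
    appendCmd.eval [a, b, c, d] = [a, b, b ++ c, []] := by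
  rw [appendCmd, Cmd.eval, Cmd.eval_clear, Cmd.eval_copy] <;> simp

/-- `copy` pushes two bits per bit read, so it is not tame and `Cmd.st` does not cover this loop.
The explicit bound holds because every round adds the same word `b`. -/
theorem size_foldl_appendCmd (w a b c d : List Bool) :
    size (w.foldl (fun s _ => appendCmd.eval s) [a, b, c, d]) ≤
      size [a, b, c, d] + w.length * b.length := by
  induction w generalizing c d with
  | nil => simp
  | cons x w ih =>
    rw [List.foldl_cons, eval_appendCmd]
    refine (ih _ _).trans ?_
    simp only [size_cons, size_nil, List.length_append, List.length_nil, List.length_cons]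
    nlinarith

theorem foldl_appendCmd (w a b c : List Bool) :
    w.foldl (fun s _ => appendCmd.eval s) [a, b, c, []] =
      [a, b, (w.flatMap fun _ => b) ++ c, []] := by
  induction w generalizing c with
  | nil => simp
  | cons x w ih =>
    rw [List.foldl_cons, eval_appendCmd, ih]
    clear ih
    have : (w.flatMap fun _ => b) ++ b = b ++ w.flatMap fun _ => b := by
      induction w with
      | nil => simp
      | cons y w ih => simp [ih]
    rw [← List.append_assoc, this]
    simp

theorem polyTime_flatMap :
    PolyTime fun a : Fin 2 → List Bool => (a 0).flatMap fun _ => a 1 := by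
  have hwf : appendCmd.Wf 4 := ⟨by simp, by simp⟩
  have h1 : ST 4 fun l => (l.getD 0 []).foldl (fun s _ => appendCmd.eval s) (l.set 0 []) := by
    refine ST.fold (F := fun _ s => appendCmd.eval s) (by norm_num) (fun _ => appendCmd.st hwf)
      (fun b l w _ => Cmd.eval_set _ (by simp [appendCmd, Cmd.Avoids, Cmd.clear, Cmd.copy, Cmd.mv]) _ _)
      (.X + .X * .X) fun l hl w hw => ?_
    match l, hl with
    | [a, b, c, d], _ =>
      refine (size_foldl_appendCmd _ _ _ _ _).trans ?_
      have := hw.length_le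
      simp only [List.getD_cons_zero, size_cons, size_nil, List.length_nil, Polynomial.eval_add,
        Polynomial.eval_mul, Polynomial.eval_X] at *
      nlinarith
  have h2 := h1.comp ((Cmd.seq (.clear 0) (.seq (.mv 2 3) (.mv 3 0))).st (k := 4)
    ⟨by simp, by simp, by simp⟩)
  refine h2.polyTime (by norm_num) fun args => ?_
  have e : List.ofFn args ++ List.replicate (4 - 2) [] = [args 0, args 1, [], []] := by
    simp [List.replicate]
  rw [e]
  simp only [List.getD_cons_zero, List.set_cons_zero, foldl_appendCmd, Cmd.eval, Cmd.eval_clear]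
  simp [Cmd.eval_mv]

/-- Addition of unary numbers is concatenation, and multiplication by the length of the input is
`polyTime_flatMap`; monomials are built by induction on the degree. -/
theorem polyTime_ones_eval (p : Polynomial ℕ) :
    PolyTime fun a : Fin 1 → List Bool => ones (p.eval (a 0).length) := by
  induction p using Polynomial.induction_on' with
  | add p q hp hq =>
    have h := (((ST.call hp (k := 3) ![0] (by simp) (r := 1) (by norm_num)).comp
      (ST.call hq (k := 3) ![0] (by simp) (r := 2) (by norm_num))).comp
      ((Cmd.seq (.mv 1 2) (.seq (.clear 0) (.mv 2 0))).st (k := 3) ⟨by simp, by simp, by simp⟩))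
    refine h.polyTime (by norm_num) fun args => ?_
    have e : List.ofFn args ++ List.replicate (3 - 1) [] = [args 0, [], []] := by
      simp [List.replicate]
    rw [e]
    simp [Cmd.eval, Cmd.eval_mv, Cmd.eval_clear, Nat.add_comm]
  | monomial n c =>
    induction n with
    | zero =>
      have h := (Cmd.seq (.clear 0) (.pushL 0 (ones c))).st (k := 1) ⟨by simp, by simp⟩
      refine h.polyTime (by norm_num) fun args => ?_
      simp [Cmd.eval, Cmd.eval_clear, Cmd.eval_pushL]
    | succ n ih =>
      have h := (ST.call ih (k := 2) ![0] (by simp) (r := 1) (by norm_num)).comp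
        (ST.call polyTime_flatMap (k := 2) ![0, 1] (by simp [Fin.forall_fin_two]) (r := 0)
          (by norm_num))
      refine h.polyTime (by norm_num) fun args => ?_
      have e : List.ofFn args ++ List.replicate (2 - 1) [] = [args 0, []] := by
        simp
      rw [e]
      have e' : ∀ (w : List Bool) (m : ℕ), (w.flatMap fun _ => ones m) = ones (w.length * m) := by
        intro w m
        induction w with
        | nil => simp
        | cons b w ih => rw [List.flatMap_cons, ih, ← List.replicate_add]; simp; ring
      simp only [List.getD_cons_zero, List.set_cons_succ, List.set_cons_zero, Matrix.cons_val_zero,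
        Matrix.cons_val_one, List.getD_cons_succ, e']
      simp [pow_succ]
      ring

/-! ## Averages over random bits -/

/-- The average of `φ` over the bit strings of length `m`. -/
noncomputable def expect : ℕ → (List Bool → ℂ) → ℂ
  | 0, φ => φ []
  | m + 1, φ => (expect m (fun r => φ (false :: r)) + expect m fun r => φ (true :: r)) / 2

theorem expect_congr {m : ℕ} {φ ψ : List Bool → ℂ} (h : ∀ r, r.length = m → φ r = ψ r) :
    expect m φ = expect m ψ := by
  induction m generalizing φ ψ with
  | zero => exact h [] rfl
  | succ m ih =>
    rw [expect, expect, ih fun r hr => h (false :: r) (by simpa using hr),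
      ih fun r hr => h (true :: r) (by simpa using hr)]

theorem expect_const (m : ℕ) (c : ℂ) : expect m (fun _ => c) = c := by
  induction m with
  | zero => rfl
  | succ m ih => rw [expect, ih]; ring

theorem expect_add (m : ℕ) (φ ψ : List Bool → ℂ) :
    expect m (fun r => φ r + ψ r) = expect m φ + expect m ψ := by
  induction m generalizing φ ψ with
  | zero => rfl
  | succ m ih => simp only [expect, ih]; ring

theorem expect_mul (m : ℕ) (c : ℂ) (φ : List Bool → ℂ) :
    expect m (fun r => c * φ r) = c * expect m φ := by
  induction m generalizing φ with
  | zero => rfl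
  | succ m ih => simp only [expect, ih]; ring

/-- Fubini: disjoint blocks of random bits can be averaged one after the other. -/
theorem expect_append (h k : ℕ) (φ : List Bool → ℂ) :
    expect (h + k) φ = expect h fun r₁ => expect k fun r₂ => φ (r₁ ++ r₂) := by
  induction h generalizing φ with
  | zero => simp [expect]
  | succ h ih => rw [show h + 1 + k = (h + k) + 1 by omega, expect, expect, ih, ih]; rfl

theorem expect_eq_sum (m : ℕ) (φ : List Bool → ℂ) :
    expect m φ = (∑ r : Fin m → Bool, φ (List.ofFn r)) / 2 ^ m := by
  induction m generalizing φ with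
  | zero => simp [expect]
  | succ m ih =>
    rw [expect, ih, ih, ← (Fin.consEquiv fun _ : Fin (m + 1) => Bool).sum_comp,
      Fintype.sum_prod_type, Fintype.sum_bool]
    simp [Fin.consEquiv]
    ring

open Classical in
/-- The indicator of a proposition. -/
noncomputable def ind (p : Prop) : ℂ := if p then 1 else 0

@[simp] theorem ind_true {p : Prop} (h : p) : ind p = 1 := if_pos h
@[simp] theorem ind_false {p : Prop} (h : ¬p) : ind p = 0 := if_neg h

theorem ncard_div_eq_expect (m : ℕ) (p : List Bool → Prop) :
    ((({r : Fin m → Bool | p (List.ofFn r)}.ncard : ℝ) / 2 ^ m : ℝ) : ℂ) =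
      expect m fun r => ind (p r) := by
  classical
  simp only [ind]
  rw [expect_eq_sum, Set.ncard_eq_toFinset_card', Finset.sum_boole]
  simp

/-! ## Path sums of quantum circuits -/

/-- A computational path: basis state, phase (in multiples of `π / 4`), a mark for each bit `1`
chosen so far, and the random bits left. -/
structure PathState (n : ℕ) where
  pos : Fin n → Bool
  phase : ℕ
  flag : List Bool
  rand : List Bool

/-- A Hadamard gate chooses the new value of its qubit at random. -/
def Gate.step {n : ℕ} : Gate n → PathState n → PathState n
  | Gate.H _, ⟨x, p, f, []⟩ => ⟨x, p, f, []⟩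
  | Gate.H q, ⟨x, p, f, false :: r⟩ => ⟨Function.update x q false, p, f, r⟩
  | Gate.H q, ⟨x, p, f, true :: r⟩ =>
      ⟨Function.update x q true, p + if x q then 4 else 0, true :: f, r⟩
  | Gate.T q, ⟨x, p, f, r⟩ => ⟨x, p + if x q then 1 else 0, f, r⟩
  | Gate.CNOT c t _, ⟨x, p, f, r⟩ => ⟨Function.update x t (xor (x t) (x c)), p, f, r⟩

def path {n : ℕ} (Q : List (Gate n)) (s : PathState n) : PathState n :=
  Q.foldl (fun s g => g.step s) s

/-- The number of Hadamard gates. -/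
def hcount {n : ℕ} : List (Gate n) → ℕ
  | [] => 0
  | Gate.H _ :: Q => hcount Q + 1
  | Gate.T _ :: Q => hcount Q
  | Gate.CNOT _ _ _ :: Q => hcount Q

/-- The sum over all paths from `x` to `0`, with `ζ` in the role of `exp(iπ/4)` and without
normalization. -/
noncomputable def amp (ζ : ℂ) {n : ℕ} : List (Gate n) → (Fin n → Bool) → ℂ
  | [], x => if x = fun _ => false then 1 else 0
  | Gate.H q :: Q, x => amp ζ Q (Function.update x q false) +
      (if x q then ζ ^ 4 else 1) * amp ζ Q (Function.update x q true)
  | Gate.T q :: Q, x => (if x q then ζ else 1) * amp ζ Q x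
  | Gate.CNOT c t _ :: Q, x => amp ζ Q (Function.update x t (xor (x t) (x c)))

variable {n : ℕ}

/-- A path consumes exactly one random bit per Hadamard gate; the surplus passes on to the second
path and to the final decision. -/
theorem path_append (Q : List (Gate n)) (x : Fin n → Bool) (p : ℕ) (f r₁ r₂ : List Bool)
    (h : r₁.length = hcount Q) :
    path Q ⟨x, p, f, r₁ ++ r₂⟩ =
      { path Q ⟨x, p, f, r₁⟩ with rand := r₂ } := by
  induction Q generalizing x p f r₁ with
  | nil => simp only [hcount, List.length_eq_zero_iff] at h; subst h; rfl
  | cons g Q ih =>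
    cases g with
    | H q =>
      rcases r₁ with _ | ⟨_ | _, r₁⟩
      · simp [hcount] at h
      · exact ih _ _ _ _ (by simpa [hcount] using h)
      · exact ih _ _ _ _ (by simpa [hcount] using h)
    | T q => exact ih _ _ _ _ h
    | CNOT c t hct => exact ih _ _ _ _ h

theorem path_H_false (q : Fin n) (Q : List (Gate n)) (x : Fin n → Bool) (p : ℕ)
    (f r : List Bool) : path (Gate.H q :: Q) ⟨x, p, f, false :: r⟩ =
      path Q ⟨Function.update x q false, p, f, r⟩ := rfl

theorem path_H_true (q : Fin n) (Q : List (Gate n)) (x : Fin n → Bool) (p : ℕ)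
    (f r : List Bool) : path (Gate.H q :: Q) ⟨x, p, f, true :: r⟩ =
      path Q ⟨Function.update x q true, p + if x q then 4 else 0, true :: f, r⟩ := rfl

/-- Each Hadamard gate averages its two branches, contributing a factor 1/2, so the mean is the path
sum over 2^h. -/
theorem expect_path (ζ : ℂ) (Q : List (Gate n)) (x : Fin n → Bool) (p : ℕ) (f : List Bool) :
    (expect (hcount Q) fun r => ind ((path Q ⟨x, p, f, r⟩).pos = fun _ => false) *
      ζ ^ (path Q ⟨x, p, f, r⟩).phase) = ζ ^ p * amp ζ Q x / 2 ^ hcount Q := by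
  induction Q generalizing x p f with
  | nil =>
    simp only [hcount, expect, path, List.foldl_nil, amp]
    by_cases h : x = fun _ => false <;> simp [h]
  | cons g Q ih =>
    cases g with
    | H q =>
      simp only [hcount, expect, path_H_false, path_H_true, ih, amp]
      split_ifs <;> ring
    | T q =>
      refine (ih x _ f).trans ?_
      simp only [amp, hcount]
      split_ifs <;> ring
    | CNOT c t hct => exact ih _ p f

/-- Only the all-zero choice string leaves no mark. This yields an event of probability exactly
2^-h, the scale on which the verifier's bias lives. -/
theorem expect_flag (Q : List (Gate n)) (x : Fin n → Bool) (p : ℕ) (f : List Bool) :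
    (expect (hcount Q) fun r => ind ((path Q ⟨x, p, f, r⟩).flag = [])) =
      ind (f = []) / 2 ^ hcount Q := by
  induction Q generalizing x p f with
  | nil => simp [hcount, expect, path]
  | cons g Q ih =>
    cases g with
    | H q =>
      simp only [hcount, expect, path_H_false, path_H_true, ih]
      rw [ind_false (p := true :: f = []) (by simp), pow_succ]
      field_simp
      ring
    | T q => exact ih _ _ _
    | CNOT c t hct => exact ih _ _ _

theorem amp_conj (ζ : ℂ) (Q : List (Gate n)) (x : Fin n → Bool) :
    amp ((starRingEnd ℂ) ζ) Q x = (starRingEnd ℂ) (amp ζ Q x) := by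
  induction Q generalizing x with
  | nil => simp only [amp]; split_ifs <;> simp
  | cons g Q ih => cases g <;> simp only [amp, ih] <;> (try split_ifs) <;> simp

/-- Pair `x` with the string in which qubit `q` is flipped and use the parallelogram law on each
pair. -/
theorem sum_hadamard (q : Fin n) (v : (Fin n → Bool) → ℂ) :
    ∑ x, ‖v (Function.update x q false) + (if x q then -1 else 1) * v (Function.update x q true)‖ ^ 2
      = 2 * ∑ x, ‖v x‖ ^ 2 := by
  let e : (Fin n → Bool) ≃ (Fin n → Bool) :=
    ⟨fun x => Function.update x q (!x q), fun x => Function.update x q (!x q),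
      fun x => by simp, fun x => by simp⟩
  set F : (Fin n → Bool) → ℝ := fun x =>
    ‖v (Function.update x q false) + (if x q then -1 else 1) * v (Function.update x q true)‖ ^ 2
  have h1 : ∑ x, F (e x) = ∑ x, F x := e.sum_comp F
  have h2 : ∑ x, ‖v (e x)‖ ^ 2 = ∑ x, ‖v x‖ ^ 2 := e.sum_comp fun x => ‖v x‖ ^ 2
  have h3 : ∀ x, F x + F (e x) = 2 * (‖v x‖ ^ 2 + ‖v (e x)‖ ^ 2) := by
    intro x
    have hp := parallelogram_law_with_norm ℝ (v (Function.update x q false))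
      (v (Function.update x q true))
    cases hx : x q
    · have hx' : Function.update x q false = x := by rw [← hx, Function.update_eq_self]
      simp only [F, e, Equiv.coe_fn_mk, hx, Function.update_idem, Function.update_self, hx'] at hp ⊢
      simp only [Bool.not_false, Bool.false_eq_true, if_false, if_true, one_mul, neg_mul,
        ← sub_eq_add_neg]
      linarith
    · have hx' : Function.update x q true = x := by rw [← hx, Function.update_eq_self]
      simp only [F, e, Equiv.coe_fn_mk, hx, Function.update_idem, Function.update_self, hx'] at hp ⊢
      simp only [Bool.not_true, Bool.false_eq_true, if_false, if_true, one_mul, neg_mul,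
        ← sub_eq_add_neg]
      linarith
  have h4 : ∑ x, (F x + F (e x)) = ∑ x, 2 * (‖v x‖ ^ 2 + ‖v (e x)‖ ^ 2) :=
    Finset.sum_congr rfl fun x _ => h3 x
  rw [Finset.sum_add_distrib, ← Finset.mul_sum, Finset.sum_add_distrib, h1, h2] at h4
  change ∑ x, F x = _
  linarith

/-- Unitarity, in unnormalized form: a Hadamard gate doubles the squared norm and the other gates
preserve it. Only ζ^4 = -1 matters, so this also covers the Galois conjugate `omega ^ 3`. -/
theorem sum_norm_amp {ζ : ℂ} (hζ : ζ ^ 4 = -1) (Q : List (Gate n)) :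
    ∑ x, ‖amp ζ Q x‖ ^ 2 = 2 ^ hcount Q := by
  have hn : ‖ζ‖ = 1 := by
    have : ‖ζ‖ ^ 4 = 1 := by rw [← norm_pow, hζ]; simp
    exact (pow_eq_one_iff_of_nonneg (norm_nonneg _) (by norm_num)).1 this
  induction Q with
  | nil =>
    simp only [amp, hcount, pow_zero]
    rw [Finset.sum_eq_single (fun _ => false)] <;> simp +contextual
  | cons g Q ih =>
    cases g with
    | H q =>
      simp only [amp, hζ, hcount]
      rw [sum_hadamard, ih, pow_succ]; ring
    | T q =>
      simp only [amp, hcount, norm_mul]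
      rw [← ih]
      refine Finset.sum_congr rfl fun x _ => ?_
      split_ifs <;> simp [hn]
    | CNOT c t h =>
      simp only [amp, hcount]
      rw [← ih]
      let e : (Fin n → Bool) ≃ (Fin n → Bool) :=
        ⟨fun x => Function.update x t (xor (x t) (x c)),
          fun x => Function.update x t (xor (x t) (x c)),
          fun x => by simp [Function.update_of_ne h], fun x => by simp [Function.update_of_ne h]⟩
      exact e.sum_comp fun x => ‖amp ζ Q x‖ ^ 2

/-- The eighth root of unity `exp(iπ/4)`. -/
noncomputable def omega : ℂ := Complex.exp (Real.pi / 4 * Complex.I)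

/-! ### Arithmetic of the eighth root of unity, and path sums as circuit amplitudes -/

theorem omega_eq : omega = (Real.sqrt 2 / 2 : ℝ) + (Real.sqrt 2 / 2 : ℝ) * Complex.I := by
  have : omega = Complex.exp ((Real.pi / 4 : ℝ) * Complex.I) := by
    rw [omega]; push_cast; rfl
  rw [this, Complex.exp_mul_I, ← Complex.ofReal_cos, ← Complex.ofReal_sin, Real.cos_pi_div_four,
    Real.sin_pi_div_four]

theorem omega_pow_four : omega ^ 4 = -1 := by
  rw [omega, ← Complex.exp_nat_mul, ← Complex.exp_pi_mul_I]
  congr 1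
  push_cast; ring

theorem conj_omega : (starRingEnd ℂ) omega = -omega ^ 3 := by
  have h : Complex.normSq omega = 1 := by
    rw [Complex.normSq_eq_norm_sq, omega]
    have := Complex.norm_exp_ofReal_mul_I (Real.pi / 4)
    push_cast at this
    rw [this]; norm_num
  have h1 := Complex.mul_conj omega
  rw [h, Complex.ofReal_one] at h1
  have h2 := omega_pow_four
  linear_combination (-omega ^ 3) * h1 + (starRingEnd ℂ) omega * h2

theorem omega_sub : omega - omega ^ 3 = (Real.sqrt 2 : ℝ) := by
  have := conj_omega
  rw [sub_eq_add_neg, ← this, Complex.add_conj, omega_eq]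
  simp
  ring

theorem circuitMatrix_eq (Q : List (Gate n)) (x : Fin n → Bool) :
    circuitMatrix Q (fun _ => false) x = amp omega Q x / (Real.sqrt 2 : ℂ) ^ hcount Q := by
  induction Q generalizing x with
  | nil =>
    simp [circuitMatrix, amp, hcount, Matrix.one_apply, eq_comm]
  | cons g Q ih =>
    rw [circuitMatrix, Matrix.mul_apply]
    simp only [ih]
    cases g with
    | H q =>
      have hne : Function.update x q false ≠ Function.update x q true := by
        intro h
        have := congrFun h q
        simp at this
      -- The column of the gate at `x` is supported on the two values of qubit `q`.
      rw [← Finset.sum_subset (Finset.subset_univ {Function.update x q false,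
        Function.update x q true}), Finset.sum_pair hne]
      · simp only [Gate.matrix, Matrix.of_apply, amp, hcount, omega_pow_four, pow_succ (Real.sqrt 2 : ℂ)]
        simp +contextual only [Function.update_of_ne, ne_eq, not_false_eq_true, implies_true,
          if_true, Function.update_self, Bool.false_eq_true, false_and, if_false, true_and]
        split_ifs <;> ring
      · intro y _ hy
        simp only [Finset.mem_insert, Finset.mem_singleton, not_or] at hy
        have : ¬ ∀ k, k ≠ q → y k = x k := by
          intro h
          have : y = Function.update x q (y q) := by
            funext k
            by_cases e : k = q
            · subst e; simp
            · simp [e, h k e]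
          cases e : y q <;> rw [e] at this
          exacts [hy.1 this, hy.2 this]
        simp [Gate.matrix, this]
    | T q =>
      simp only [Gate.matrix, amp, hcount]
      rw [Finset.sum_eq_single x]
      · simp only [Matrix.diagonal_apply_eq]
        split_ifs
        · rw [omega]; ring
        · ring
      · intro y _ hy; simp [Matrix.diagonal_apply_ne _ hy]
      · simp
    | CNOT c t h =>
      simp only [Gate.matrix, amp, hcount, Matrix.of_apply]
      rw [Finset.sum_eq_single (Function.update x t (xor (x t) (x c)))]
      · simp
      · intro y _ hy; simp [hy]
      · simp

theorem acceptProb_eq (Q : List (Gate n)) :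
    acceptProb Q = ‖amp omega Q fun _ => false‖ ^ 2 / 2 ^ hcount Q := by
  rw [acceptProb, circuitMatrix_eq, norm_div, norm_pow, div_pow, ← pow_mul, mul_comm, pow_mul]
  congr 2
  rw [Complex.norm_real, Real.norm_of_nonneg (Real.sqrt_nonneg _), Real.sq_sqrt (by norm_num)]

/-- The sign that the verifier attaches to a phase. -/
noncomputable def phaseSign (p : ℕ) : ℂ := if (p + 1) % 8 < 4 then 1 else -1

/-- Fourier expansion on ℤ/8. The sign is antiperiodic under `p ↦ p + 4`, so only the four primitive
eighth roots of unity occur. -/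
theorem phaseSign_eq (p : ℕ) : phaseSign p =
    (1 + omega - omega ^ 2 - omega ^ 3) / 4 * omega ^ p +
    (1 + omega + omega ^ 2 - omega ^ 3) / 4 * (-omega ^ 3) ^ p +
    (1 - omega + omega ^ 2 + omega ^ 3) / 4 * (omega ^ 3) ^ p +
    (1 - omega - omega ^ 2 + omega ^ 3) / 4 * (-omega) ^ p := by
  have h := omega_pow_four
  have h8 : omega ^ 8 = 1 := by rw [show 8 = 4 * 2 by norm_num, pow_mul, h]; norm_num
  have hp : ∀ ζ : ℂ, ζ ^ 8 = 1 → ζ ^ p = ζ ^ (p % 8) := by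
    intro ζ hζ
    conv_lhs => rw [← Nat.div_add_mod p 8, pow_add, pow_mul, hζ, one_pow, one_mul]
  have h3 : (omega ^ 3) ^ 8 = 1 := by rw [← pow_mul, mul_comm, pow_mul, h8, one_pow]
  rw [hp _ h8, hp _ h3, hp (-omega ^ 3) (by rw [Even.neg_pow (by decide), h3]),
    hp (-omega) (by rw [Even.neg_pow (by decide), h8]), phaseSign, Nat.add_mod]
  have hlt : p % 8 < 8 := Nat.mod_lt _ (by norm_num)
  generalize p % 8 = r at *
  generalize omega = w at *
  interval_cases r <;> norm_num <;> grind

/-- The two paths of the verifier: the second one starts with the inverse of the phase of the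
first one. -/
def pathPair (Q : List (Gate n)) (r₁ r₂ : List Bool) : PathState n × PathState n :=
  let s := path Q ⟨fun _ => false, 0, [], r₁⟩
  (s, path Q ⟨fun _ => false, 7 * s.phase, [], r₂⟩)

/-- Both paths end in `0`. -/
def ValidPair (s : PathState n × PathState n) : Prop :=
  (s.1.pos = fun _ => false) ∧ s.2.pos = fun _ => false

instance (s : PathState n × PathState n) : Decidable (ValidPair s) :=
  inferInstanceAs (Decidable (_ ∧ _))

/-- Starting the second path at phase `7 * s.phase` multiplies its weight by the conjugate of the
first one's. Independence turns the mean into amplitude times conjugate amplitude. -/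
theorem expect_pathPair {ζ : ℂ} (h7 : ζ ^ 7 = (starRingEnd ℂ) ζ) (Q : List (Gate n)) :
    (expect (hcount Q) fun r₁ => expect (hcount Q) fun r₂ =>
      ind (ValidPair (pathPair Q r₁ r₂)) * ζ ^ (pathPair Q r₁ r₂).2.phase) =
      ((‖amp ζ Q fun _ => false‖ ^ 2 : ℝ) : ℂ) / 4 ^ hcount Q := by
  have h1 : ∀ r₁, (expect (hcount Q) fun r₂ =>
      ind (ValidPair (pathPair Q r₁ r₂)) * ζ ^ (pathPair Q r₁ r₂).2.phase) =
      (amp ζ Q (fun _ => false) / 2 ^ hcount Q) *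
        (ind ((path Q ⟨fun _ => false, 0, [], r₁⟩).pos = fun _ => false) *
          ((starRingEnd ℂ) ζ) ^ (path Q ⟨fun _ => false, 0, [], r₁⟩).phase) := by
    intro r₁
    by_cases h : (path Q ⟨fun _ => false, 0, [], r₁⟩).pos = fun _ => false
    · simp only [ValidPair, pathPair, h, true_and]
      rw [expect_path, pow_mul, h7, ind_true trivial]; ring
    · simp only [ValidPair, pathPair, h, false_and, ind_false not_false, zero_mul, expect_const,
        mul_zero]
  simp only [h1]
  rw [expect_mul, expect_path, amp_conj, pow_zero, one_mul, div_mul_div_comm, Complex.mul_conj,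
    Complex.normSq_eq_norm_sq, ← mul_pow]
  norm_num

/-- The acceptance probability of the verifier, given its two paths. -/
noncomputable def pairProb (s : PathState n × PathState n) : ℂ :=
  1 / 2 + 1 / 4 * (ind (ValidPair s) * phaseSign s.2.phase) -
    1 / 8 * ind (s.1.flag = [])

/-- The Fourier terms at conjugate roots have equal moduli. Their coefficients add up to (1 + √2)/2
for `omega` and (1 - √2)/2 for `omega ^ 3`; the verifier's weight 1/4 makes these eighths. -/
theorem expect_pairProb (Q : List (Gate n)) :
    (expect (hcount Q) fun r₁ => expect (hcount Q) fun r₂ => pairProb (pathPair Q r₁ r₂)) =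
      ((1 / 2 + ((1 + √2) / 8 * acceptProb Q +
        (1 - √2) / 8 * (‖amp (omega ^ 3) Q fun _ => false‖ ^ 2 / 2 ^ hcount Q) - 1 / 8) /
          2 ^ hcount Q : ℝ) : ℂ) := by
  have hω := omega_pow_four
  have hc := conj_omega
  have e1 := expect_pathPair (ζ := omega) (by rw [hc]; linear_combination omega ^ 3 * hω) Q
  have e3 := expect_pathPair (ζ := omega ^ 3) (by rw [map_pow, hc]; grind) Q
  have e7 := expect_pathPair (ζ := -omega ^ 3)
    (by rw [map_neg, map_pow, hc]; grind) Q
  have e5 := expect_pathPair (ζ := -omega) (by rw [map_neg, hc]; grind) Q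
  have n7 : ‖amp (-omega ^ 3) Q fun _ => false‖ = ‖amp omega Q fun _ => false‖ := by
    rw [← hc, amp_conj, RCLike.norm_conj]
  have n5 : ‖amp (-omega) Q fun _ => false‖ = ‖amp (omega ^ 3) Q fun _ => false‖ := by
    rw [← RCLike.norm_conj (amp (omega ^ 3) Q _), ← amp_conj, map_pow, hc]
    congr 2
    grind
  rw [n7] at e7
  rw [n5] at e5
  have hsplit : ∀ s : PathState n × PathState n, pairProb s = 1 / 2 +
      ((1 + omega - omega ^ 2 - omega ^ 3) / 16 *
        (ind (ValidPair s) * omega ^ s.2.phase) +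
      ((1 + omega + omega ^ 2 - omega ^ 3) / 16 *
        (ind (ValidPair s) * (-omega ^ 3) ^ s.2.phase) +
      ((1 - omega + omega ^ 2 + omega ^ 3) / 16 *
        (ind (ValidPair s) * (omega ^ 3) ^ s.2.phase) +
      ((1 - omega - omega ^ 2 + omega ^ 3) / 16 *
        (ind (ValidPair s) * (-omega) ^ s.2.phase) +
      (-1 / 8) * ind (s.1.flag = []))))) := by
    intro s
    rw [pairProb]
    rw [phaseSign_eq]; ring
  have hfl : (expect (hcount Q) fun r₁ => expect (hcount Q) fun r₂ =>
      ind ((pathPair Q r₁ r₂).1.flag = [])) = 1 / 2 ^ hcount Q := by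
    simp only [pathPair, expect_const]
    rw [expect_flag, ind_true rfl]
  simp only [hsplit, expect_add, expect_mul, expect_const, e1, e3, e5, e7, hfl]
  rw [acceptProb_eq]
  have h2 : (Real.sqrt 2 : ℂ) = omega - omega ^ 3 := omega_sub.symm
  have h4 : (4 : ℂ) ^ hcount Q = 2 ^ hcount Q * 2 ^ hcount Q := by rw [← mul_pow]; norm_num
  push_cast
  rw [h2, h4]
  field_simp
  ring

/-- The decision of the verifier, given its two paths and at least three random bits. -/
def decision (s : PathState n × PathState n) : List Bool → Bool
  | false :: c :: _ => if ValidPair s then (s.2.phase + 1) % 8 < 4 else c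
  | true :: c :: c' :: _ => c && !(decide (s.1.flag = []) && c')
  | _ => false

/-- The first coin selects the sign test or the correction, each with weight 1/2. An invalid pair is
replaced by a fair coin, and the correction loses 1/4 exactly when the flag is empty. -/
theorem expect_decision (s : PathState n × PathState n) (k : ℕ) :
    (expect (3 + k) fun r => ind (decision s r = true)) = pairProb s := by
  rw [expect_append]
  simp only [expect, List.cons_append, decision, expect_const, pairProb, phaseSign, List.nil_append]
  by_cases h1 : ValidPair s <;> by_cases h2 : s.1.flag = [] <;>
    by_cases h3 : (s.2.phase + 1) % 8 < 4 <;> simp [h1, h2, h3] <;> norm_num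

theorem half_le_expect_iff (Q : List (Gate n)) :
    (2 / 3 ≤ acceptProb Q → ∃ x : ℝ, 1 / 2 ≤ x ∧ (expect (hcount Q) fun r₁ =>
      expect (hcount Q) fun r₂ => pairProb (pathPair Q r₁ r₂)) = x) ∧
    (acceptProb Q ≤ 1 / 3 → ∃ x : ℝ, x < 1 / 2 ∧ (expect (hcount Q) fun r₁ =>
      expect (hcount Q) fun r₂ => pairProb (pathPair Q r₁ r₂)) = x) := by
  have hx : ‖amp (omega ^ 3) Q fun _ => false‖ ^ 2 / 2 ^ hcount Q ≤ 1 := by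
    rw [div_le_one (by positivity), ← sum_norm_amp (ζ := omega ^ 3) (by
      rw [← pow_mul, mul_comm, pow_mul, omega_pow_four]; norm_num) Q]
    exact Finset.single_le_sum (f := fun x => ‖amp (omega ^ 3) Q x‖ ^ 2)
      (fun _ _ => by positivity) (Finset.mem_univ _)
  have hx0 : 0 ≤ ‖amp (omega ^ 3) Q fun _ => false‖ ^ 2 / 2 ^ hcount Q := by positivity
  have hs : √2 ^ 2 = 2 := Real.sq_sqrt (by norm_num)
  have hs0 := Real.sqrt_nonneg 2
  have hs1 : 1 < √2 := by nlinarith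
  have hs2 : √2 < 3 / 2 := by nlinarith
  rw [expect_pairProb]
  generalize ‖amp (omega ^ 3) Q fun _ => false‖ ^ 2 / 2 ^ hcount Q = y at *
  generalize √2 = z at *
  refine ⟨fun h => ⟨_, ?_, rfl⟩, fun h => ⟨_, ?_, rfl⟩⟩
  -- Worst case: acceptance 2/3 and `y = 1`, where the numerator is (2 - √2)/24.
  · have : 0 ≤ ((1 + z) / 8 * acceptProb Q + (1 - z) / 8 * y - 1 / 8) / 2 ^ hcount Q :=
      div_nonneg (by nlinarith) (by positivity)
    linarith
  -- Worst case: acceptance 1/3 and `y = 0`, where the numerator is (√2 - 2)/24.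
  · have : ((1 + z) / 8 * acceptProb Q + (1 - z) / 8 * y - 1 / 8) / 2 ^ hcount Q < 0 :=
      div_neg_of_neg_of_pos (by nlinarith) (by positivity)
    linarith

/-! ## The verifier for quantum circuits as a program

Registers: `0` code of the circuit, `1` random bits, `2` qubits, `3` qubits passed (reversed),
`4`, `5` mode, `6` flag, `7` value of the control qubit, `8` phase, `9` second copy of the code,
`10` auxiliary, `11` marks invalid paths, `12` flag of the first path. -/

theorem ones_succ (n : ℕ) : ones (n + 1) = true :: ones n := rfl

open Cmd in
/-- The action on a bit `1` of the code. -/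
def oneBit : Cmd :=
  branch 4 (branch 5 (push 2 false) (push 4 true) (push 4 false))
    (branch 2 skip (seq (pop 2) (push 3 false)) (seq (pop 2) (push 3 true)))
    (branch 2 skip (seq (pop 2) (push 3 false)) (seq (pop 2) (push 3 true)))

open Cmd in
def applyH : Cmd :=
  seq (branch 1 skip (seq (pop 1) (seq (pop 2) (push 2 false)))
    (seq (pop 1) (seq (push 6 true)
      (branch 2 skip (seq (pop 2) (push 2 true)) (pushL 8 (ones 4))))))
    (seq (mv 3 2) (pop 4))

open Cmd in
def applyT : Cmd :=
  seq (branch 2 skip skip (push 8 true)) (seq (mv 3 2) (seq (pop 4) (seq (pop 5) (push 5 false))))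

open Cmd in
def readControl : Cmd :=
  seq (branch 2 skip skip (push 7 true)) (seq (mv 3 2) (seq (pop 5) (push 5 true)))

open Cmd in
def applyCNOT : Cmd :=
  seq (branch 7 skip skip (seq (pop 7)
    (branch 2 skip (seq (pop 2) (push 2 true)) (seq (pop 2) (push 2 false)))))
    (seq (mv 3 2) (seq (pop 4) (seq (pop 5) (push 5 false))))

open Cmd in
/-- The action on a bit `0` of the code. -/
def zeroBit : Cmd :=
  branch 4
    (branch 5 (push 5 false) (seq (pop 5) (push 5 true))
      (seq (pop 5) (seq (push 5 false) (push 4 false))))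
    (branch 5 skip applyH applyT)
    (branch 5 skip readControl applyCNOT)

/-- Registers `4` and `5` hold the parser state. `5` empty: header with the number of qubits. `4`
empty: `5` is `[false]` between gates and `[true]` after a first `0`. Otherwise a qubit index is
being read: `4`, `5` equal `[false]`, `[false]` for H, `[false]`, `[true]` for T, `[true]`,
`[false]` for a control, `[true]`, `[true]` for a target. -/
def readBit (s : Regs) (b : Bool) : Regs := cond b (oneBit.eval s) (zeroBit.eval s)

/-- A unary qubit index acts as a cursor: each `1` shifts a qubit to register `3`, so that the
addressed qubit comes to the top of register `2`. -/
theorem readBit_advance (q : ℕ) (A r B L m2 F ctl P c t i pf : List Bool) (m : Bool)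
    (hA : A.length = q) :
    (ones q).foldl readBit [[], r, A ++ B, L, [m], m2, F, ctl, P, c, t, i, pf] =
      [[], r, B, A.reverse ++ L, [m], m2, F, ctl, P, c, t, i, pf] := by
  induction q generalizing A L with
  | zero => simp only [List.length_eq_zero_iff] at hA; subst hA; rfl
  | succ q ih =>
    obtain ⟨a, A, rfl⟩ := List.exists_cons_of_length_eq_add_one hA
    rw [ones_succ, List.foldl_cons, List.reverse_cons, List.append_assoc]
    have := ih A ([a] ++ L) (by simpa using hA)
    rw [← this]
    congr 1
    cases m <;> cases a <;> rfl

theorem foldl_readBit_init (n : ℕ) (r F P c t i pf : List Bool) :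
    (unary n).foldl readBit [[], r, [], [], [], [], F, [], P, c, t, i, pf] =
      [[], r, List.replicate n false, [], [], [false], F, [], P, c, t, i, pf] := by
  have : ∀ R, (ones n).foldl readBit [[], r, R, [], [], [], F, [], P, c, t, i, pf] =
      [[], r, List.replicate n false ++ R, [], [], [], F, [], P, c, t, i, pf] := by
    induction n with
    | zero => intro R; rfl
    | succ n ih =>
      intro R
      rw [ones_succ, List.foldl_cons, List.replicate_succ']
      rw [List.append_assoc]
      exact ih (false :: R)
  rw [unary, List.foldl_append, this, List.append_nil]
  rfl

theorem readBit_H (A B r F P c t i pf : List Bool) (x : Bool) :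
    readBit [[], r, x :: B, A.reverse, [false], [false], F, [], P, c, t, i, pf] false =
      match r with
      | [] => [[], [], A ++ x :: B, [], [], [false], F, [], P, c, t, i, pf]
      | false :: r => [[], r, A ++ false :: B, [], [], [false], F, [], P, c, t, i, pf]
      | true :: r => [[], r, A ++ true :: B, [], [], [false], true :: F, [],
          (if x then ones 4 else []) ++ P, c, t, i, pf] := by
  rcases r with _ | ⟨_ | _, r⟩ <;> cases x <;>
    simp [readBit, zeroBit, Cmd.eval, sel, applyH, Cmd.eval_mv, Cmd.eval_pushL]

theorem readBit_T (A B r F P c t i pf : List Bool) (x : Bool) :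
    readBit [[], r, x :: B, A.reverse, [false], [true], F, [], P, c, t, i, pf] false =
      [[], r, A ++ x :: B, [], [], [false], F, [], (if x then [true] else []) ++ P, c, t, i, pf] := by
  cases x <;> simp [readBit, zeroBit, Cmd.eval, sel, applyT, Cmd.eval_mv]

theorem readBit_control (A B r F P c t i pf : List Bool) (x : Bool) :
    readBit [[], r, x :: B, A.reverse, [true], [false], F, [], P, c, t, i, pf] false =
      [[], r, A ++ x :: B, [], [true], [true], F, if x then [true] else [], P, c, t, i, pf] := by
  cases x <;> simp [readBit, zeroBit, Cmd.eval, sel, readControl, Cmd.eval_mv]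

theorem readBit_CNOT (A B r F P c t i pf : List Bool) (x y : Bool) :
    readBit [[], r, x :: B, A.reverse, [true], [true], F, if y then [true] else [], P, c, t, i, pf]
      false = [[], r, A ++ xor x y :: B, [], [], [false], F, [], P, c, t, i, pf] := by
  cases x <;> cases y <;> simp [readBit, zeroBit, Cmd.eval, sel, applyCNOT, Cmd.eval_mv]

variable {n : ℕ}

theorem ofFn_eq_append (x : Fin n → Bool) (q : Fin n) :
    ∃ A B : List Bool, A.length = (q : ℕ) ∧ List.ofFn x = A ++ x q :: B ∧
      ∀ b, List.ofFn (Function.update x q b) = A ++ b :: B := by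
  refine ⟨(List.ofFn x).take q, (List.ofFn x).drop (q + 1), by simp, ?_, fun b => ?_⟩
  · conv_lhs => rw [← List.take_append_drop q (List.ofFn x)]
    rw [List.drop_eq_getElem_cons (by simp)]
    simp
  · apply List.ext_getElem
    · simp; omega
    · intro i h1 h2
      simp only [List.getElem_ofFn, List.getElem_append, List.length_take, List.length_ofFn,
        List.getElem_take, List.getElem_cons, List.getElem_drop]
      simp only [List.length_ofFn] at h1
      have hq := q.isLt
      by_cases h : i < q
      · have : (⟨i, h1⟩ : Fin n) ≠ q := fun e => by simp [← e] at h
        simp [h, this]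
      · by_cases h' : i = q
        · subst h'; simp
        · have : (⟨i, h1⟩ : Fin n) ≠ q := fun e => by simp [← e] at h'
          simp only [ne_eq, this, not_false_eq_true, Function.update_of_ne]
          rw [dif_neg (by omega), dif_neg (by omega)]
          congr 2; omega

/-- The registers that represent a path. -/
def pathRegs (c t i pf : List Bool) (s : PathState n) : Regs :=
  [[], s.rand, List.ofFn s.pos, [], [], [false], s.flag, [], ones s.phase, c, t, i, pf]

theorem foldl_readBit_gate (g : Gate n) (s : PathState n) (c t i pf : List Bool) :
    g.encode.foldl readBit (pathRegs c t i pf s) = pathRegs c t i pf (g.step s) := by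
  obtain ⟨x, p, f, r⟩ := s
  cases g with
  | H q =>
    obtain ⟨A, B, hA, hx, hu⟩ := ofFn_eq_append x q
    have h0 : ([false, false] : List Bool).foldl readBit (pathRegs c t i pf ⟨x, p, f, r⟩) =
      [[], r, A ++ x q :: B, [], [false], [false], f, [], ones p, c, t, i, pf] := by
      rw [pathRegs, hx]; rfl
    rw [Gate.encode, unary, List.foldl_append, List.foldl_append, h0, readBit_advance _ _ _ _ _ _ _ _ _ _ _ _ _ _ hA,
      List.append_nil, List.foldl_cons, List.foldl_nil, readBit_H]
    rcases r with _ | ⟨_ | _, r⟩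
    · simp [Gate.step, pathRegs, hx]
    · simp [Gate.step, pathRegs, hu]
    · simp only [Gate.step, pathRegs, hu]
      cases x q <;> simp [List.replicate_succ]
  | T q =>
    obtain ⟨A, B, hA, hx, hu⟩ := ofFn_eq_append x q
    have h0 : ([false, true] : List Bool).foldl readBit (pathRegs c t i pf ⟨x, p, f, r⟩) =
      [[], r, A ++ x q :: B, [], [false], [true], f, [], ones p, c, t, i, pf] := by
      rw [pathRegs, hx]; rfl
    rw [Gate.encode, unary, List.foldl_append, List.foldl_append, h0, readBit_advance _ _ _ _ _ _ _ _ _ _ _ _ _ _ hA,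
      List.append_nil, List.foldl_cons, List.foldl_nil, readBit_T]
    simp only [Gate.step, pathRegs, hx]
    cases x q <;> simp [List.replicate_succ]
  | CNOT a b hab =>
    obtain ⟨A, B, hA, hx, hu⟩ := ofFn_eq_append x a
    obtain ⟨A', B', hA', hx', hu'⟩ := ofFn_eq_append x b
    have h0 : ([true] : List Bool).foldl readBit (pathRegs c t i pf ⟨x, p, f, r⟩) =
      [[], r, A ++ x a :: B, [], [true], [false], f, [], ones p, c, t, i, pf] := by
      rw [pathRegs, hx]; rfl
    rw [Gate.encode, unary, List.foldl_append, List.foldl_append, List.foldl_append, h0,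
      readBit_advance _ _ _ _ _ _ _ _ _ _ _ _ _ _ hA, List.append_nil, List.foldl_cons, List.foldl_nil, readBit_control, ← hx,
      unary, List.foldl_append, hx', readBit_advance _ _ _ _ _ _ _ _ _ _ _ _ _ _ hA',
      List.append_nil, List.foldl_cons, List.foldl_nil, readBit_CNOT]
    simp only [Gate.step, pathRegs, hu']

theorem foldl_readBit_circuit (Q : List (Gate n)) (s : PathState n) (c t i pf : List Bool) :
    (Q.flatMap Gate.encode).foldl readBit (pathRegs c t i pf s) =
      pathRegs c t i pf (path Q s) := by
  induction Q generalizing s with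
  | nil => rfl
  | cons g Q ih => rw [List.flatMap_cons, List.foldl_append, foldl_readBit_gate, ih]; rfl

theorem foldl_readBit_encode (Q : List (Gate n)) (r f c t i pf : List Bool) (p : ℕ) :
    (encodeCircuit n Q).foldl readBit [[], r, [], [], [], [], f, [], ones p, c, t, i, pf] =
      pathRegs c t i pf (path Q ⟨fun _ => false, p, f, r⟩) := by
  rw [encodeCircuit, List.foldl_append, foldl_readBit_init, ← foldl_readBit_circuit, pathRegs,
    List.ofFn_const]

def readCode : Cmd := .fold 0 zeroBit oneBit

def markInvalid : Cmd := .fold 2 .skip (.push 11 true)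

open Cmd in
/-- Prepare the second path. -/
def betweenPaths : Cmd :=
  seq markInvalid (seq (fold 8 (pushL 10 (ones 7)) (pushL 10 (ones 7))) (seq (mv 10 8)
    (seq (mv 6 12) (seq (pop 5) (seq (mv 9 10) (mv 10 0))))))

open Cmd in
/-- Add `1` to the number with the binary digits in the registers `3`, `4`, `7`, modulo `8`. -/
def increment : Cmd :=
  branch 3 (push 3 true) skip (seq (pop 3) (branch 4 (push 4 true) skip (seq (pop 4)
    (branch 7 (push 7 true) skip (pop 7)))))

open Cmd in
/-- Output the decision. -/
def output : Cmd :=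
  branch 1 (push 0 false)
    (seq (pop 1) (branch 11 (branch 7 (push 0 true) (push 0 false) (push 0 false)) skip
      (branch 1 (push 0 false) (push 0 false) (push 0 true))))
    (seq (pop 1) (branch 1 (push 0 false) (push 0 false) (seq (pop 1)
      (branch 12 (branch 1 (push 0 false) (push 0 true) (push 0 false)) (push 0 true)
        (push 0 true)))))

open Cmd in
/-- Evaluate the two paths. -/
def finish : Cmd :=
  seq markInvalid (seq (push 3 true) (seq (fold 8 increment increment) output))

/-- Reading consumes the code, hence the copy kept in register `9` for the second path. -/
def verifierCmd : Cmd :=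
  .seq (.copy 0 10 9) (.seq readCode (.seq betweenPaths (.seq readCode finish)))

/-! ### Correctness of the verifier program -/

theorem wf_verifierCmd : verifierCmd.Wf 13 := by
  simp [verifierCmd, Cmd.Wf, Cmd.Avoids, Cmd.Tame, finish, output, increment, betweenPaths,
    markInvalid, readCode, zeroBit, oneBit, applyH, applyT, readControl, applyCNOT]

theorem eval_readCode (w r R L m1 m2 F ctl P c t i pf : List Bool) :
    readCode.eval [w, r, R, L, m1, m2, F, ctl, P, c, t, i, pf] =
      w.foldl readBit [[], r, R, L, m1, m2, F, ctl, P, c, t, i, pf] := rfl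

theorem eval_markInvalid (w r R L m1 m2 F ctl P c t i pf : List Bool) :
    markInvalid.eval [w, r, R, L, m1, m2, F, ctl, P, c, t, i, pf] =
      [w, r, [], L, m1, m2, F, ctl, P, c, t, ones (R.count true) ++ i, pf] := by
  rw [markInvalid, Cmd.eval]
  simp only [List.getD_cons_succ, List.getD_cons_zero, List.set_cons_succ, List.set_cons_zero]
  induction R generalizing i with
  | nil => rfl
  | cons b R ih =>
    cases b
    · exact ih i
    · refine (ih (true :: i)).trans ?_
      simp [List.replicate_succ']

/-- Multiplying a phase by 7 negates it modulo 8. -/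
theorem foldl_pushSeven (u w r R L m1 m2 F ctl P c t i pf : List Bool) :
    u.foldl (fun s x => cond x ((Cmd.pushL 10 (ones 7)).eval s) ((Cmd.pushL 10 (ones 7)).eval s))
      [w, r, R, L, m1, m2, F, ctl, P, c, t, i, pf] =
      [w, r, R, L, m1, m2, F, ctl, P, c, ones (7 * u.length) ++ t, i, pf] := by
  induction u generalizing t with
  | nil => rfl
  | cons b u ih =>
    rw [List.foldl_cons]
    have : (cond b ((Cmd.pushL 10 (ones 7)).eval [w, r, R, L, m1, m2, F, ctl, P, c, t, i, pf])
      ((Cmd.pushL 10 (ones 7)).eval [w, r, R, L, m1, m2, F, ctl, P, c, t, i, pf])) =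
      [w, r, R, L, m1, m2, F, ctl, P, c, ones 7 ++ t, i, pf] := by cases b <;> rfl
    rw [this, ih, List.length_cons, ← List.append_assoc, ← List.replicate_add, Nat.mul_succ]

theorem eval_betweenPaths (s : PathState n) (c i : List Bool) :
    betweenPaths.eval (pathRegs c [] i [] s) = [c, s.rand, [], [], [], [], [], [],
      ones (7 * s.phase), [], [], ones ((List.ofFn s.pos).count true) ++ i, s.flag.reverse] := by
  simp only [betweenPaths, Cmd.eval, pathRegs, eval_markInvalid]
  simp only [List.getD_cons_succ, List.getD_cons_zero, List.set_cons_succ, List.set_cons_zero,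
    foldl_pushSeven]
  simp [Cmd.eval_mv]

/-- The digits of `m` modulo `8` in the registers `3`, `4`, `7`. -/
def counterRegs (w r R m2 F P c t i pf : List Bool) (m : ℕ) : Regs :=
  [w, r, R, if m % 2 = 1 then [true] else [], if m / 2 % 2 = 1 then [true] else [], m2, F,
    if m / 4 % 2 = 1 then [true] else [], P, c, t, i, pf]

theorem eval_increment (w r R m2 F P c t i pf : List Bool) (m : ℕ) :
    increment.eval (counterRegs w r R m2 F P c t i pf m) =
      counterRegs w r R m2 F P c t i pf (m + 1) := by
  have e : ∀ m, counterRegs w r R m2 F P c t i pf m = counterRegs w r R m2 F P c t i pf (m % 8) := by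
    intro m
    simp only [counterRegs]
    rw [show m % 8 % 2 = m % 2 by omega, show m % 8 / 2 % 2 = m / 2 % 2 by omega,
      show m % 8 / 4 % 2 = m / 4 % 2 by omega]
  rw [e m, e (m + 1), Nat.add_mod]
  have : m % 8 < 8 := Nat.mod_lt _ (by norm_num)
  interval_cases m % 8 <;> rfl

theorem foldl_increment (u w r R m2 F P c t i pf : List Bool) (m : ℕ) :
    u.foldl (fun s x => cond x (increment.eval s) (increment.eval s))
      (counterRegs w r R m2 F P c t i pf m) =
      counterRegs w r R m2 F P c t i pf (m + u.length) := by
  induction u generalizing m with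
  | nil => rfl
  | cons b u ih =>
    rw [List.foldl_cons]
    have : (cond b (increment.eval (counterRegs w r R m2 F P c t i pf m))
      (increment.eval (counterRegs w r R m2 F P c t i pf m))) =
      counterRegs w r R m2 F P c t i pf (m + 1) := by cases b <;> exact eval_increment ..
    rw [this, ih, List.length_cons, Nat.add_right_comm, Nat.add_assoc]

theorem count_ofFn_eq_zero (x : Fin n → Bool) :
    (List.ofFn x).count true = 0 ↔ x = fun _ => false := by
  rw [List.count_eq_zero]
  simp [List.mem_ofFn, funext_iff]

theorem eval_finish (s : PathState n × PathState n) (k : ℕ)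
    (hk : k = 0 ↔ s.1.pos = fun _ => false) (hr : 3 ≤ s.2.rand.length) :
    (finish.eval (pathRegs [] [] (ones k) s.1.flag.reverse s.2)).getD 0 [] =
      [decision s s.2.rand] := by
  obtain ⟨s₁, x, p, f, r⟩ := s
  obtain ⟨e, r, rfl⟩ := List.exists_cons_of_length_pos (l := r) (by simp at hr; omega)
  obtain ⟨c, r, rfl⟩ := List.exists_cons_of_length_pos (l := r) (by simp at hr; omega)
  obtain ⟨c', r, rfl⟩ := List.exists_cons_of_length_pos (l := r) (by simp at hr; omega)
  -- The counter starts at 1, which is the shift in `(p + 1) % 8`.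
  have e1 : ∀ P i pf, (Cmd.push 3 true).eval
      [[], e :: c :: c' :: r, [], [], [], [false], f, [], P, [], [], i, pf] =
      counterRegs [] (e :: c :: c' :: r) [] [false] f P [] [] i pf 1 := fun _ _ _ => rfl
  have e2 : ∀ i pf, (Cmd.fold 8 increment increment).eval
      (counterRegs [] (e :: c :: c' :: r) [] [false] f (ones p) [] [] i pf 1) =
      counterRegs [] (e :: c :: c' :: r) [] [false] f [] [] [] i pf (1 + p) := by
    intro i pf
    have := foldl_increment (ones p) [] (e :: c :: c' :: r) [] [false] f [] [] [] i pf 1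
    rwa [List.length_replicate] at this
  have e3 : finish.eval (pathRegs [] [] (ones k) s₁.flag.reverse ⟨x, p, f, e :: c :: c' :: r⟩) =
      output.eval (counterRegs [] (e :: c :: c' :: r) [] [false] f [] [] []
        (ones ((List.ofFn x).count true + k)) s₁.flag.reverse (1 + p)) := by
    rw [finish, Cmd.eval, pathRegs, eval_markInvalid, Cmd.eval, e1, Cmd.eval, e2,
      ← List.replicate_add]
  rw [e3]
  have h3 : (List.ofFn x).count true + k = 0 ↔
      ValidPair (s₁, (⟨x, p, f, e :: c :: c' :: r⟩ : PathState n)) := by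
    rw [Nat.add_eq_zero_iff, count_ofFn_eq_zero, hk, ValidPair, and_comm]
  -- The sign is the third binary digit of the counter, stored in register `7`.
  have h4 : (1 + p) / 4 % 2 = 1 ↔ ¬(p + 1) % 8 < 4 := by omega
  have h5 : s₁.flag.reverse = [] ↔ s₁.flag = [] := List.reverse_eq_nil_iff
  generalize (List.ofFn x).count true + k = K at *
  generalize s₁.flag.reverse = pf at *
  simp only [counterRegs, output, Cmd.eval, List.getD_cons_succ, List.getD_cons_zero,
    List.set_cons_succ, List.set_cons_zero, List.tail_cons]
  cases e
  · by_cases hv : ValidPair (s₁, (⟨x, p, f, false :: c :: c' :: r⟩ : PathState n))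
    · obtain rfl := h3.2 hv
      by_cases h8 : (p + 1) % 8 < 4 <;> simp [sel, decision, hv, h8, h4]
    · obtain ⟨K, rfl⟩ := Nat.exists_eq_succ_of_ne_zero (mt h3.1 hv)
      cases c <;> simp [sel, decision, hv, List.replicate_succ]
  · rcases pf with _ | ⟨_ | _, pf⟩ <;> cases c <;> cases c' <;>
      simp [sel, decision, ← h5]

/-- The verifier: run two random paths of the circuit that `f` generates. -/
def verifier (f : (Fin 1 → List Bool) → List Bool) (args : Fin 2 → List Bool) : List Bool :=
  (verifierCmd.eval (f ![args 0] :: args 1 :: List.replicate 11 [])).getD 0 []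

theorem polyTime_verifier {f : (Fin 1 → List Bool) → List Bool} (hf : PolyTime f) :
    PolyTime (verifier f) := by
  refine ((ST.call hf (k := 13) ![0] (by simp) (r := 0) (by norm_num)).comp
    (verifierCmd.st wf_verifierCmd)).polyTime (by norm_num) fun args => ?_
  rw [verifier]
  congr 2
  have e : List.ofFn args ++ List.replicate (13 - 2) [] =
      args 0 :: args 1 :: List.replicate 11 [] := by simp [List.ofFn_succ]
  rw [e, List.set_cons_zero]
  congr 2
  funext i
  simp [Fin.fin_one_eq_zero i]

theorem verifier_eq {f : (Fin 1 → List Bool) → List Bool} {x : List Bool} {Q : List (Gate n)}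
    (hf : f ![x] = encodeCircuit n Q) {r₁ r₂ r : List Bool} (h₁ : r₁.length = hcount Q)
    (h₂ : r₂.length = hcount Q) (hr : 3 ≤ r.length) :
    verifier f ![x, r₁ ++ (r₂ ++ r)] = [decision (pathPair Q r₁ r₂) r] := by
  have e1 : (Cmd.copy 0 10 9).eval ((encodeCircuit n Q) :: (r₁ ++ (r₂ ++ r)) ::
      List.replicate 11 []) = [encodeCircuit n Q, r₁ ++ (r₂ ++ r), [], [], [], [], [], [], [],
      encodeCircuit n Q, [], [], []] := by
    rw [Cmd.eval_copy] <;> simp [List.replicate_succ]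
  have e2 : (Cmd.eval readCode [encodeCircuit n Q, r₁ ++ (r₂ ++ r), [], [], [], [], [], [], [],
      encodeCircuit n Q, [], [], []]) = pathRegs (encodeCircuit n Q) [] [] []
        (path Q ⟨fun _ => false, 0, [], r₁ ++ (r₂ ++ r)⟩) := by
    rw [eval_readCode]
    exact foldl_readBit_encode Q _ _ _ _ _ _ 0
  have e0 : ![x, r₁ ++ (r₂ ++ r)] 0 = x := rfl
  have e0' : ![x, r₁ ++ (r₂ ++ r)] 1 = r₁ ++ (r₂ ++ r) := rfl
  rw [verifier, e0, e0', hf]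
  simp only [verifierCmd, Cmd.eval, e1, e2, eval_betweenPaths, eval_readCode]
  rw [foldl_readBit_encode, path_append _ _ _ _ _ _ h₁]
  dsimp only
  rw [path_append _ _ _ _ _ _ h₂, List.append_nil]
  have h := eval_finish ((path Q ⟨fun _ => false, 0, [], r₁⟩, { path Q ⟨fun _ => false,
    7 * (path Q ⟨fun _ => false, 0, [], r₁⟩).phase, [], r₂⟩ with rand := r }) :
      PathState n × PathState n) _ (count_ofFn_eq_zero _) hr
  exact h

/-- `BQP ⊆ PP`. -/
theorem BQP_subset_PP : BQP ⊆ PP := by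
  rintro L ⟨f, hf, hyes, hno⟩
  obtain ⟨P, q, hP⟩ := id hf
  refine ⟨verifier f, 2 * (.X + q) + 3, polyTime_verifier hf, ?_⟩
  have key : ∀ (x : List Bool) (n : ℕ) (Q : List (Gate n)), f ![x] = encodeCircuit n Q →
      ((randAcceptProb (verifier f) ((2 * (.X + q) + 3 : Polynomial ℕ).eval x.length) x : ℝ) : ℂ) =
        expect (hcount Q) fun r₁ => expect (hcount Q) fun r₂ => pairProb (pathPair Q r₁ r₂) := by
    intro x n Q hQ
    -- The description is written one bit per step into a register that initially holds `x`, and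
    -- each gate takes at least one bit.
    have hh : hcount Q ≤ x.length + q.eval x.length := by
      obtain ⟨σ, t, hex, ht, hσ⟩ := hP ![x]
      have h1 := hex.length_le 0
      rw [hσ, hQ] at h1
      have h2 : hcount Q ≤ (encodeCircuit n Q).length := by
        rw [encodeCircuit, List.length_append]
        refine le_trans ?_ (Nat.le_add_left _ _)
        clear hQ h1
        induction Q with
        | nil => simp [hcount]
        | cons g Q ih =>
          cases g <;> simp [hcount, Gate.encode, unary] at ih ⊢ <;> omega
      have h3 : ((inputs (List.ofFn ![x])) 0).length = x.length := by simp [inputs]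
      simp at ht
      omega
    -- Two paths and three decision coins; `k` coins are left over.
    obtain ⟨k, hk⟩ : ∃ k, (2 * (.X + q) + 3 : Polynomial ℕ).eval x.length =
        hcount Q + (hcount Q + (3 + k)) := by
      refine ⟨2 * (x.length + q.eval x.length) - 2 * hcount Q, ?_⟩
      simp only [Polynomial.eval_add, Polynomial.eval_mul, Polynomial.eval_ofNat,
        Polynomial.eval_X]
      omega
    rw [hk, randAcceptProb, ncard_div_eq_expect _ fun r => verifier f ![x, r] = [true],
      expect_append]
    refine expect_congr fun r₁ h₁ => ?_
    rw [expect_append]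
    refine expect_congr fun r₂ h₂ => ?_
    rw [← expect_decision _ k]
    refine expect_congr fun r hr => ?_
    rw [verifier_eq hQ h₁ h₂ (by omega)]
    simp
  constructor
  · intro x hx
    obtain ⟨n, Q, hQ, hp⟩ := hyes x hx
    obtain ⟨y, hy, e⟩ := (half_le_expect_iff Q).1 hp
    rw [← key x n Q hQ, Complex.ofReal_inj] at e
    rwa [e]
  · intro x hx
    obtain ⟨n, Q, hQ, hp⟩ := hno x hx
    obtain ⟨y, hy, e⟩ := (half_le_expect_iff Q).2 hp
    rw [← key x n Q hQ, Complex.ofReal_inj] at e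
    rwa [e]

/-! ## The log-determinant of a diagonal matrix counts accepting computations -/

theorem indexBits_length {n : ℕ} (i : Fin (2 ^ n)) : (indexBits i).length = n := by
  simp [indexBits]

theorem testBit_injective (n : ℕ) : Function.Injective
    fun (i : Fin (2 ^ n)) (k : Fin n) => (i : ℕ).testBit k := by
  intro i j h
  refine Fin.ext (Nat.eq_of_testBit_eq fun k => ?_)
  by_cases hk : k < n
  · exact congrFun h ⟨k, hk⟩
  · have : ∀ i : Fin (2 ^ n), (i : ℕ).testBit k = false := fun i =>
      Nat.testBit_lt_two_pow (i.isLt.trans_le (Nat.pow_le_pow_right (by norm_num) (by omega)))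
    rw [this, this]

theorem indexBits_injective {n : ℕ} {i j : Fin (2 ^ n)} (h : indexBits i = indexBits j) :
    i = j := testBit_injective n (List.ofFn_injective h)

theorem sum_indexBits (n : ℕ) (φ : List Bool → ℂ) :
    ∑ i : Fin (2 ^ n), φ (indexBits i) = ∑ r : Fin n → Bool, φ (List.ofFn r) := by
  have hb : Function.Bijective fun (i : Fin (2 ^ n)) (k : Fin n) => (i : ℕ).testBit k :=
    (Fintype.bijective_iff_injective_and_card _).2 ⟨testBit_injective n, by simp⟩
  exact (Equiv.ofBijective _ hb).sum_comp fun r => φ (List.ofFn r)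

variable (V : (Fin 2 → List Bool) → List Bool) (m : ℕ) (x : List Bool) (n : ℕ)

/-- The computation accepts, when its random bits are the first digits of `i`. -/
def Accepts (i : Fin (2 ^ n)) : Prop := V ![x, (indexBits i).take m] = [true]

open Classical in
noncomputable def diagEntry (i : Fin (2 ^ n)) : ℝ :=
  if Accepts V m x n i then 1 - (1 / 2) ^ (m + 1) else 1

/-- The diagonal matrix whose entries tell which computations accept. -/
noncomputable def countingMatrix : Matrix (Fin (2 ^ n)) (Fin (2 ^ n)) ℂ :=
  Matrix.diagonal fun i => (diagEntry V m x n i : ℂ)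

/-- The index bits after the first `m` are ignored, so the accepted fraction is unaffected by
padding. -/
theorem ncard_accepts (h : m ≤ n) :
    ({i | Accepts V m x n i}.ncard : ℝ) = randAcceptProb V m x * 2 ^ n := by
  classical
  have h1 : (∑ i : Fin (2 ^ n), ind (Accepts V m x n i)) / 2 ^ n =
      ((randAcceptProb V m x : ℝ) : ℂ) := by
    unfold Accepts
    rw [sum_indexBits n fun w => ind (V ![x, w.take m] = [true]), ← expect_eq_sum n fun w => ind (V ![x, w.take m] = [true]),
      randAcceptProb, ncard_div_eq_expect m fun w => V ![x, w] = [true]]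
    obtain ⟨k, rfl⟩ := Nat.exists_eq_add_of_le h
    rw [expect_append]
    refine expect_congr fun r hr => ?_
    simp [← hr, expect_const]
  rw [div_eq_iff (pow_ne_zero _ two_ne_zero)] at h1
  have h2 : (({i | Accepts V m x n i}.ncard : ℝ) : ℂ) =
      ∑ i : Fin (2 ^ n), ind (Accepts V m x n i) := by
    rw [Set.ncard_eq_toFinset_card']
    simp only [ind, Finset.sum_boole]
    simp
  rw [h1] at h2
  exact_mod_cast h2

theorem half_pow_bounds : 0 < (1 / 2 : ℝ) ^ (m + 1) ∧ (1 / 2 : ℝ) ^ (m + 1) ≤ 1 / 2 :=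
  ⟨by positivity, pow_le_of_le_one (by norm_num) (by norm_num) (by omega)⟩

theorem diagEntry_mem (i : Fin (2 ^ n)) : diagEntry V m x n i ∈ Set.Icc (1 / 2 : ℝ) 1 := by
  have := half_pow_bounds m
  unfold diagEntry
  split_ifs <;> constructor <;> linarith

theorem log_det_countingMatrix : Real.log (countingMatrix V m x n).det.re =
    {i | Accepts V m x n i}.ncard * Real.log (1 - (1 / 2) ^ (m + 1)) := by
  classical
  rw [countingMatrix, Matrix.det_diagonal, ← Complex.ofReal_prod, Complex.ofReal_re,
    Real.log_prod fun i _ => ?_]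
  · rw [Set.ncard_eq_toFinset_card']
    simp only [diagEntry, apply_ite Real.log, Real.log_one]
    rw [Finset.sum_ite]
    simp
  · have := (diagEntry_mem V m x n i).1
    linarith

open scoped ComplexOrder in
theorem posSemidef_countingMatrix : (countingMatrix V m x n).PosSemidef := by
  refine Matrix.PosSemidef.diagonal fun i => ?_
  have := (diagEntry_mem V m x n i).1
  simp only [Pi.zero_apply, Complex.zero_le_real]
  linarith

/-- If `μ` differs from all diagonal entries, then `μ - A` is diagonal with non-zero determinant. -/
theorem spectrum_countingMatrix :
    spectrum ℝ (countingMatrix V m x n) ⊆ Set.Icc (1 / 2) 1 := by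
  intro μ hμ
  by_contra hn
  refine hμ ?_
  have hne : ∀ i, ((μ - diagEntry V m x n i : ℝ) : ℂ) ≠ 0 := by
    intro i h
    rw [Complex.ofReal_eq_zero, sub_eq_zero] at h
    exact hn (h ▸ diagEntry_mem V m x n i)
  have e : algebraMap ℝ (Matrix (Fin (2 ^ n)) (Fin (2 ^ n)) ℂ) μ - countingMatrix V m x n =
      Matrix.diagonal fun i => ((μ - diagEntry V m x n i : ℝ) : ℂ) := by
    rw [Matrix.algebraMap_eq_diagonal, countingMatrix, Matrix.diagonal_sub]
    congr 1
    funext i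
    simp
  rw [spectrum.mem_resolventSet_iff, e, Matrix.isUnit_iff_isUnit_det, Matrix.det_diagonal, isUnit_iff_ne_zero]
  exact Finset.prod_ne_zero_iff.2 fun i _ => hne i

/-- Apply log(1 + t) ≥ 2t/(t + 2) at t = δ/(1 - δ). The quadratic term is essential: at acceptance
probability exactly 1/2 it supplies the whole margin below the threshold. -/
theorem log_one_sub_le {δ : ℝ} (h0 : 0 < δ) (h1 : δ < 1) :
    Real.log (1 - δ) ≤ -(δ + δ ^ 2 / 2) := by
  have h2 : 0 < 1 - δ := by linarith
  have h := Real.le_log_one_add_of_nonneg (x := δ / (1 - δ)) (by positivity)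
  have e : 1 + δ / (1 - δ) = (1 - δ)⁻¹ := by field_simp; ring
  rw [e, Real.log_inv] at h
  have e2 : 2 * (δ / (1 - δ)) / (δ / (1 - δ) + 2) = 2 * δ / (2 - δ) := by
    have : 2 - δ ≠ 0 := by linarith
    have : δ + 2 * (1 - δ) ≠ 0 := by linarith
    field_simp
    ring
  rw [e2] at h
  have h3 : δ + δ ^ 2 / 2 ≤ 2 * δ / (2 - δ) := by
    rw [le_div_iff₀ (by linarith)]
    nlinarith [pow_pos h0 3]
  linarith

theorem le_log_one_sub {δ : ℝ} (h1 : δ < 1) : -(δ / (1 - δ)) ≤ Real.log (1 - δ) := by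
  have h2 : 0 < 1 - δ := by linarith
  have h := Real.one_sub_inv_le_log_of_pos h2
  have e : 1 - (1 - δ)⁻¹ = -(δ / (1 - δ)) := by field_simp; ring
  linarith

/-- An estimate of the log-determinant decides whether at least half of the computations
accept. -/
theorem estimate_decides {K : ℕ} (hK : m + 1 ≤ K) {z : ℝ}
    (hz : |z - Real.log (countingMatrix V m x (m + 2 + K)).det.re| ≤ 1 / 4) :
    (1 / 2 ≤ randAcceptProb V m x → z ≤ -2 ^ K) ∧
      (randAcceptProb V m x < 1 / 2 → ¬ z ≤ -2 ^ K) := by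
  rw [log_det_countingMatrix, ncard_accepts V m x _ (by omega)] at hz
  obtain ⟨hδ0, hδ1⟩ := half_pow_bounds m
  have hδm : (1 / 2 : ℝ) ^ (m + 1) * 2 ^ m = 1 / 2 := by
    rw [pow_succ, mul_assoc, mul_comm (1 / 2 : ℝ), ← mul_assoc, ← mul_pow]; norm_num
  -- Here `m + 1 ≤ K` enters: the padding lifts the relative gap δ to a constant.
  have hD : (1 : ℝ) ≤ 2 ^ K * (1 / 2) ^ (m + 1) := by
    obtain ⟨j, rfl⟩ := Nat.exists_eq_add_of_le hK
    have e : (2 : ℝ) ^ (m + 1 + j) * (1 / 2) ^ (m + 1) = 2 ^ j := by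
      rw [pow_add, mul_right_comm, ← mul_pow]; norm_num
    rw [e]
    exact one_le_pow₀ (by norm_num)
  -- Hence half of the indices, weighted by δ, give exactly 2^K.
  have hn : (2 : ℝ) ^ (m + 2 + K) * (1 / 2) ^ (m + 1) = 2 * 2 ^ K := by
    rw [show m + 2 + K = (m + 1) + (K + 1) by ring, pow_add, mul_right_comm, ← mul_pow]
    norm_num; ring
  have hl1 := log_one_sub_le hδ0 (by linarith)
  have hl2 := le_log_one_sub (δ := (1 / 2 : ℝ) ^ (m + 1)) (by linarith)
  obtain ⟨hz1, hz2⟩ := abs_le.1 hz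
  have hN0 : (0 : ℝ) < 2 ^ (m + 2 + K) := by positivity
  constructor
  · intro hp
    have h1 : 2 ^ (m + 2 + K) / 2 ≤ randAcceptProb V m x * 2 ^ (m + 2 + K) := by nlinarith
    generalize randAcceptProb V m x * 2 ^ (m + 2 + K) = N at *
    generalize (1 / 2 : ℝ) ^ (m + 1) = δ at *
    generalize (2 : ℝ) ^ (m + 2 + K) = M at *
    generalize (2 : ℝ) ^ K = D at *
    have h2 : N * Real.log (1 - δ) ≤ N * -(δ + δ ^ 2 / 2) :=
      mul_le_mul_of_nonneg_left hl1 (by linarith)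
    have h3 : M / 2 * (δ + δ ^ 2 / 2) ≤ N * (δ + δ ^ 2 / 2) :=
      mul_le_mul_of_nonneg_right h1 (by positivity)
    -- The excess `D * δ / 2` is at least 1/2, more than the error 1/4.
    have h4 : M / 2 * (δ + δ ^ 2 / 2) = D + D * δ / 2 := by
      linear_combination (1 / 2 + δ / 4) * hn
    nlinarith
  · intro hp
    -- The number of accepting coin strings is an integer, so being below half means missing it by
    -- at least one half.
    have h1 : randAcceptProb V m x ≤ 1 / 2 - (1 / 2) ^ (m + 1) := by
      rw [randAcceptProb, div_lt_iff₀ (by positivity)] at hp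
      rw [randAcceptProb, div_le_iff₀ (by positivity), sub_mul, hδm]
      generalize {r : Fin m → Bool | V ![x, List.ofFn r] = [true]}.ncard = c at *
      have : 2 * c < 2 ^ m := by
        have : (2 * c : ℝ) < 2 ^ m := by linarith
        exact_mod_cast this
      have : (2 * c + 1 : ℝ) ≤ 2 ^ m := by exact_mod_cast this
      linarith
    have h2 : randAcceptProb V m x * 2 ^ (m + 2 + K) ≤
      (1 / 2 - (1 / 2) ^ (m + 1)) * 2 ^ (m + 2 + K) := mul_le_mul_of_nonneg_right h1 hN0.le
    have hN : 0 ≤ randAcceptProb V m x * 2 ^ (m + 2 + K) := by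
      unfold randAcceptProb; positivity
    generalize randAcceptProb V m x * 2 ^ (m + 2 + K) = N at *
    generalize (1 / 2 : ℝ) ^ (m + 1) = δ at *
    generalize (2 : ℝ) ^ (m + 2 + K) = M at *
    have hD0 : 0 ≤ (2 : ℝ) ^ K := by positivity
    generalize (2 : ℝ) ^ K = D at *
    have h3 : N * -(δ / (1 - δ)) ≤ N * Real.log (1 - δ) := mul_le_mul_of_nonneg_left hl2 hN
    have h4 : N * (δ / (1 - δ)) ≤ (1 / 2 - δ) * M * (δ / (1 - δ)) :=
      mul_le_mul_of_nonneg_right h2 (div_nonneg hδ0.le (by linarith))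
    -- This is (1 - 2δ)/(1 - δ) ≤ 1 - δ, that is, δ² ≥ 0. The log-determinant is thus at least -D +
    -- Dδ, and Dδ ≥ 1.
    have h5 : (1 / 2 - δ) * M * (δ / (1 - δ)) ≤ D * (1 - δ) := by
      rw [← mul_div_assoc, div_le_iff₀ (by linarith)]
      have : (1 / 2 - δ) * M * δ = (1 / 2 - δ) * (2 * D) := by rw [mul_assoc, hn]
      rw [this]
      nlinarith [mul_nonneg hD0 (sq_nonneg δ)]
    intro hle
    nlinarith

variable {V m x n}

/-- The bit string determines the matrix. -/
theorem DescribesMatrix.unique {κ s τ : Polynomial ℕ} {w : List Bool} {n n' : ℕ}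
    {A : Matrix (Fin (2 ^ n)) (Fin (2 ^ n)) ℂ} {A' : Matrix (Fin (2 ^ n')) (Fin (2 ^ n')) ℂ}
    (h : DescribesMatrix κ s τ w n A) (h' : DescribesMatrix κ s τ w n' A') :
    A.det = A'.det ∧ n = n' := by
  obtain ⟨⟨e, r, c, hw, hA⟩, -⟩ := h
  obtain ⟨⟨e', r', c', hw', hA'⟩, -⟩ := h'
  rw [hw] at hw'
  simp only [List.append_assoc] at hw'
  obtain ⟨rfl, h1⟩ := unary_append_inj hw'
  obtain ⟨rfl, -⟩ := Prog.encode_append_inj h1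
  refine ⟨congrArg _ (Matrix.ext fun i j => ?_), rfl⟩
  obtain ⟨σ, t, hex, -, hσ⟩ := hA.entry_spec i j
  obtain ⟨σ', t', hex', -, hσ'⟩ := hA'.entry_spec i j
  rw [← hσ, ← hσ', hex.det hex']

/-! ### Comparison of binary numbers with powers of two -/

theorem two_pow_le_ofDigits_iff (w : List Bool) (p : ℕ) :
    2 ^ p ≤ Nat.ofDigits 2 (w.map Bool.toNat) ↔ true ∈ w.drop p := by
  induction w generalizing p with
  | nil => simp
  | cons b w ih =>
    rw [List.map_cons, Nat.ofDigits_cons]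
    cases p with
    | zero =>
      have := ih 0
      simp only [pow_zero, List.drop_zero] at this
      rw [pow_zero, List.drop_zero, List.mem_cons, ← this]
      cases b
      · simp
        omega
      · simp

    | succ p =>
      rw [List.drop_succ_cons, ← ih p, pow_succ]
      have : b.toNat ≤ 1 := by cases b <;> simp
      omega

theorem intVal_cons (b : Bool) (w : List Bool) : intVal (b :: w) =
    (if b then -1 else 1) * ((Nat.ofDigits 2 (w.map Bool.toNat) : ℕ) : ℤ) := by
  rw [Nat.coe_ofDigits ℤ, Nat.cast_ofNat]; rfl

/-- Clearing the denominator turns the bound into 2^(K + |k|) on the absolute value, which holds iff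
some digit from that position on is `1`; high zeros are allowed. -/
theorem realVal_le_neg_two_pow_iff (a k : List Bool) (K : ℕ) :
    realVal a k ≤ -2 ^ K ↔ a.head? = some true ∧ true ∈ a.tail.drop (K + k.length) := by
  have hk : (0 : ℝ) < 2 ^ k.length := by positivity
  have hK : (0 : ℝ) < 2 ^ K := by positivity
  rw [realVal, div_le_iff₀ hk]
  rcases a with _ | ⟨_ | _, w⟩
  · simp only [intVal, Int.cast_zero, List.head?_nil, reduceCtorEq, false_and, iff_false, not_le]
    nlinarith
  · simp only [intVal_cons, List.head?_cons, Option.some.injEq, Bool.false_eq_true, false_and,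
      iff_false, not_le, if_false, one_mul]
    generalize Nat.ofDigits 2 (w.map Bool.toNat) = N
    have : (0 : ℝ) ≤ N := Nat.cast_nonneg _
    push_cast
    nlinarith [mul_pos hK hk]
  · rw [List.tail_cons, ← two_pow_le_ofDigits_iff]
    simp only [intVal_cons, if_true, List.head?_cons, true_and]
    generalize Nat.ofDigits 2 (w.map Bool.toNat) = N
    rw [← Nat.cast_le (α := ℝ), pow_add]
    push_cast
    constructor <;> intro h <;> linarith

/-! ## The access programs -/

/-- Push the bits of `w` on register `r`, then run `P`. -/
def chain (r : ℕ) (w : List Bool) (P : Prog) : Prog :=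
  w.foldl (fun Q b => .seq (.push r b) Q) P

theorem Runs.chain {r : ℕ} {w : List Bool} {P : Prog} {l l' : Regs} {T : ℕ} (hr : r < l.length)
    (h : Runs P (l.set r (w ++ l.getD r [])) l' T) :
    Runs (chain r w P) l l' (w.length + T) := by
  induction w generalizing P T with
  | nil =>
    rw [List.nil_append, set_getD_self] at h
    exact h.mono (by simp)
  | cons b w ih =>
    have h1 : Runs (.push r b) (l.set r (w ++ l.getD r [])) (l.set r (b :: w ++ l.getD r [])) 1 := by
      refine ⟨1, le_rfl, ?_⟩
      have := Exec.push r b (inputs (l.set r (w ++ l.getD r [])))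
      rw [inputs_set (by simpa using hr), List.set_set] at this
      simpa [inputs, hr] using this
    exact (ih (h1.seq h)).mono (by simp; omega)

/-- Bits that are to be put in front of the code of `P` to get the code of `chain r [b] P`. -/
def pushCode (r : ℕ) (b : Bool) : List Bool := [false, true, true] ++ (Prog.push r b).encode

/-- Hardwiring data only prepends fixed blocks to the code, one per bit, so a simple fold can write
it. -/
theorem encode_chain (r : ℕ) (w : List Bool) (P : Prog) :
    (chain r w P).encode = w.foldl (fun u b => pushCode r b ++ u) P.encode := by
  induction w generalizing P with
  | nil => rfl
  | cons b w ih =>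
    refine (ih _).trans ?_
    simp [Prog.encode, pushCode]

open Cmd in
/-- Move as many bits from register `0` to register `7` as it holds, and mark them in `3`. -/
def takePrefix : Cmd :=
  let body := seq (branch 0 skip (seq (pop 0) (push 4 false)) (seq (pop 0) (push 4 true)))
    (push 3 true)
  seq (fold 7 body body) (mv 4 7)

open Cmd in
/-- Compare the indices in the registers `0` and `1`; mark a difference in register `2`. -/
def entryPre : Cmd :=
  seq (fold 1
    (branch 0 skip (seq (pop 0) (push 4 false)) (seq (pop 0) (seq (push 4 true) (push 2 true))))
    (branch 0 skip (seq (pop 0) (seq (push 4 false) (push 2 true))) (seq (pop 0) (push 4 true))))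
    (seq (mv 4 0) takePrefix)

def rowPre : Cmd := .seq (.copy 0 4 1) takePrefix

open Cmd in
/-- Run `a` if register `6` holds the single bit `1`, otherwise `b`. -/
def ifAccepted (a b : Cmd) : Cmd := branch 6 b b (seq (pop 6) (branch 6 a b b))

-- The entry is (2^(m+1) - 1)/2^(m+1): numerator and unary exponent both consist of `m + 1` ones,
-- and a sign bit precedes the numerator.
open Cmd in
def entryAccept : Cmd :=
  seq (clear 0) (seq (fold 3 (seq (push 0 true) (push 2 true)) (seq (push 0 true) (push 2 true)))
    (seq (push 0 true) (seq (push 2 true) (push 0 false))))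

open Cmd in
def entryReject : Cmd := seq (clear 0) (seq (push 0 true) (push 0 false))

open Cmd in
/-- Output the entry. -/
def entryPost : Cmd :=
  branch 2 (ifAccepted entryAccept entryReject) (seq (clear 0) (clear 1)) (seq (clear 0) (clear 1))

open Cmd in
def rowAccept : Cmd :=
  seq (fold 3 (seq (push 2 true) (push 4 true)) (seq (push 2 true) (push 4 true)))
    (seq (push 2 true) (seq (push 4 true) (push 2 false)))

open Cmd in
def rowReject : Cmd := seq (clear 3) (seq (push 2 true) (push 2 false))

open Cmd in
/-- Report the diagonal entry. -/
def rowPost : Cmd := seq (ifAccepted rowAccept rowReject) (seq (clear 0) (push 0 true))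

/-! ### Well-formedness and effect of the access programs -/

theorem wf_entryPre : entryPre.Wf 8 := by
  simp [entryPre, takePrefix, Cmd.Wf, Cmd.Avoids, Cmd.Tame]

theorem wf_rowPre : rowPre.Wf 8 := by
  simp [rowPre, takePrefix, Cmd.Wf, Cmd.Avoids, Cmd.Tame]

theorem wf_entryPost : entryPost.Wf 8 := by
  simp [entryPost, entryAccept, entryReject, ifAccepted, Cmd.Wf, Cmd.Avoids, Cmd.Tame]

theorem wf_rowPost : rowPost.Wf 8 := by
  simp [rowPost, rowAccept, rowReject, ifAccepted, Cmd.Wf, Cmd.Avoids, Cmd.Tame]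

theorem eval_takePrefix (w j f x o : List Bool) (h : o.length ≤ w.length) :
    takePrefix.eval [w, j, f, [], [], [], x, o] =
      [w.drop o.length, j, f, ones o.length, [], [], x, w.take o.length] := by
  simp only [takePrefix, Cmd.eval, List.getD_cons_zero, List.getD_cons_succ, List.set_cons_succ,
    List.set_cons_zero]
  have : ∀ (o w c r : List Bool), o.length ≤ w.length →
      o.foldl (fun s x => cond x
        ((sel (s.getD 0 []) s ((s.set 0 (s.getD 0 []).tail).set 4 (false :: (s.set 0 (s.getD 0 []).tail).getD 4 []))
          ((s.set 0 (s.getD 0 []).tail).set 4 (true :: (s.set 0 (s.getD 0 []).tail).getD 4 []))).set 3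
          (true :: (sel (s.getD 0 []) s ((s.set 0 (s.getD 0 []).tail).set 4 (false :: (s.set 0 (s.getD 0 []).tail).getD 4 []))
          ((s.set 0 (s.getD 0 []).tail).set 4 (true :: (s.set 0 (s.getD 0 []).tail).getD 4 []))).getD 3 []))
        ((sel (s.getD 0 []) s ((s.set 0 (s.getD 0 []).tail).set 4 (false :: (s.set 0 (s.getD 0 []).tail).getD 4 []))
          ((s.set 0 (s.getD 0 []).tail).set 4 (true :: (s.set 0 (s.getD 0 []).tail).getD 4 []))).set 3
          (true :: (sel (s.getD 0 []) s ((s.set 0 (s.getD 0 []).tail).set 4 (false :: (s.set 0 (s.getD 0 []).tail).getD 4 []))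
          ((s.set 0 (s.getD 0 []).tail).set 4 (true :: (s.set 0 (s.getD 0 []).tail).getD 4 []))).getD 3 [])))
      [w, j, f, c, r, [], x, []] =
        [w.drop o.length, j, f, ones o.length ++ c, (w.take o.length).reverse ++ r, [], x, []] := by
    intro o
    induction o with
    | nil => intro w c r _; simp
    | cons b o ih =>
      intro w c r h
      obtain ⟨a, w, rfl⟩ := List.exists_cons_of_length_pos (l := w) (by simp at h; omega)
      rw [List.foldl_cons]
      refine Eq.trans ?_ ((ih w (true :: c) (a :: r) (by simpa using h)).trans ?_)
      · congr 1
        cases b <;> cases a <;> rfl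
      · simp [List.replicate_succ']
  rw [this o w [] [] h]
  simp [Cmd.eval_mv]

/-- Prepares the call: the hardwired `o`, used only for its length, is replaced in register `7` by
the index prefix serving as coins, and a unary copy is kept for the exponent. `f` collects one mark
per differing bit. -/
theorem eval_entryPre (w w' x o : List Bool) (hw : w.length = w'.length)
    (h : o.length ≤ w.length) : ∃ f, (f = [] ↔ w = w') ∧ f.length ≤ w.length ∧
    entryPre.eval [w, w', [], [], [], [], x, o] =
      [w.drop o.length, [], f, ones o.length, [], [], x, w.take o.length] := by
  have key : ∀ (w' w r f : List Bool), w.length = w'.length → ∃ g, (g = [] ↔ w = w') ∧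
      g.length ≤ w.length ∧
      (Cmd.fold 1 (.branch 0 .skip (.seq (.pop 0) (.push 4 false))
        (.seq (.pop 0) (.seq (.push 4 true) (.push 2 true))))
        (.branch 0 .skip (.seq (.pop 0) (.seq (.push 4 false) (.push 2 true)))
          (.seq (.pop 0) (.push 4 true)))).eval [w, w', f, [], r, [], x, o] =
      [[], [], g ++ f, [], w.reverse ++ r, [], x, o] := by
    intro w'
    induction w' with
    | nil =>
      intro w r f hw
      simp only [List.length_nil, List.length_eq_zero_iff] at hw
      subst hw
      exact ⟨[], by simp, by simp, rfl⟩
    | cons b w' ih =>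
      intro w r f hw
      obtain ⟨a, w, rfl⟩ := List.exists_cons_of_length_eq_add_one hw
      have hw' : w.length = w'.length := by simpa using hw
      by_cases hab : a = b
      · obtain ⟨g, hg1, hg2, hg3⟩ := ih w (a :: r) f hw'
        refine ⟨g, by simp [hg1, hab], by simp; omega, ?_⟩
        rw [List.reverse_cons, List.append_assoc]
        refine Eq.trans ?_ hg3
        subst hab
        cases a <;> rfl
      · obtain ⟨g, hg1, hg2, hg3⟩ := ih w (a :: r) (true :: f) hw'
        refine ⟨g ++ [true], by simp [hab], by simp; omega, ?_⟩
        rw [List.reverse_cons, List.append_assoc, List.append_assoc]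
        refine Eq.trans ?_ hg3
        cases a <;> cases b <;> first | exact absurd rfl hab | rfl
  obtain ⟨g, hg1, hg2, hg3⟩ := key w' w [] [] hw
  refine ⟨g, hg1, hg2, ?_⟩
  rw [entryPre, Cmd.eval, hg3, Cmd.eval]
  have : (Cmd.mv 4 0).eval [[], [], g ++ [], [], w.reverse ++ [], [], x, o] =
      [w, [], g, [], [], [], x, o] := by simp [Cmd.eval_mv]
  rw [this, eval_takePrefix _ _ _ _ _ h]

theorem eval_rowPre (w x o : List Bool) (h : o.length ≤ w.length) :
    rowPre.eval [w, [], [], [], [], [], x, o] =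
      [w.drop o.length, w, [], ones o.length, [], [], x, w.take o.length] := by
  rw [rowPre, Cmd.eval, Cmd.eval_copy] <;> simp [eval_takePrefix, h]

theorem eval_ifAccepted (a b : Cmd) (w j f o u s v r : List Bool) :
    (v = [true] → (ifAccepted a b).eval [w, j, f, o, u, s, v, r] =
      a.eval [w, j, f, o, u, s, [], r]) ∧
    (v ≠ [true] → ∃ v', (ifAccepted a b).eval [w, j, f, o, u, s, v, r] =
      b.eval [w, j, f, o, u, s, v', r]) := by
  constructor
  · rintro rfl; rfl
  · intro h
    rcases v with _ | ⟨_ | _, _ | ⟨_ | _, v⟩⟩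
    exacts [⟨_, rfl⟩, ⟨_, rfl⟩, ⟨_, rfl⟩, ⟨_, rfl⟩, absurd rfl h, ⟨_, rfl⟩, ⟨_, rfl⟩]

theorem foldl_push_ones_zero_two (k : ℕ) (a b j u s v r : List Bool) :
    (Cmd.fold 3 (.seq (.push 0 true) (.push 2 true)) (.seq (.push 0 true) (.push 2 true))).eval
      [a, j, b, ones k, u, s, v, r] = [ones k ++ a, j, ones k ++ b, [], u, s, v, r] := by
  induction k generalizing a b with
  | zero => rfl
  | succ k ih =>
    refine (ih (true :: a) (true :: b)).trans ?_
    simp [List.replicate_succ']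

theorem foldl_push_ones_two_four (k : ℕ) (a b i j s v r : List Bool) :
    (Cmd.fold 3 (.seq (.push 2 true) (.push 4 true)) (.seq (.push 2 true) (.push 4 true))).eval
      [i, j, a, ones k, b, s, v, r] = [i, j, ones k ++ a, [], ones k ++ b, s, v, r] := by
  induction k generalizing a b with
  | zero => rfl
  | succ k ih =>
    refine (ih (true :: a) (true :: b)).trans ?_
    simp [List.replicate_succ']

theorem eval_entryAccept (k : ℕ) (w j u s v r : List Bool) :
    entryAccept.eval [w, j, [], ones k, u, s, v, r] =
      [false :: ones (k + 1), j, ones (k + 1), [], u, s, v, r] := by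
  have h := foldl_push_ones_zero_two k [] [] j u s v r
  rw [List.append_nil] at h
  rw [entryAccept, Cmd.eval, Cmd.eval_clear, List.set_cons_zero, Cmd.eval, h]
  rfl

theorem eval_entryReject (w j f o u s v r : List Bool) :
    entryReject.eval [w, j, f, o, u, s, v, r] = [[false, true], j, f, o, u, s, v, r] := by
  rw [entryReject, Cmd.eval, Cmd.eval_clear]
  rfl

theorem eval_rowAccept (k : ℕ) (w j s v r : List Bool) :
    rowAccept.eval [w, j, [], ones k, [], s, v, r] =
      [w, j, false :: ones (k + 1), [], ones (k + 1), s, v, r] := by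
  have h := foldl_push_ones_two_four k [] [] w j s v r
  rw [List.append_nil] at h
  rw [rowAccept, Cmd.eval, h]
  rfl

theorem eval_rowReject (w j o u s v r : List Bool) :
    rowReject.eval [w, j, [], o, u, s, v, r] = [w, j, [false, true], [], u, s, v, r] := by
  rw [rowReject, Cmd.eval, Cmd.eval_clear]
  rfl

theorem complexVal_ones (k : ℕ) : complexVal (false :: ones k) [] (ones k) =
    ((1 - (1 / 2) ^ k : ℝ) : ℂ) := by
  have h : ∀ k, ((Nat.ofDigits 2 ((ones k).map Bool.toNat) : ℕ) : ℂ) = 2 ^ k - 1 := by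
    intro k
    induction k with
    | zero => simp
    | succ k ih =>
      rw [ones_succ, List.map_cons, Nat.ofDigits_cons]
      push_cast at ih ⊢
      rw [ih]
      simp; ring
  rw [complexVal, intVal_cons]
  have h' := h k
  generalize Nat.ofDigits 2 ((ones k).map Bool.toNat) = N at *
  have h2 : (2 : ℂ) ^ k ≠ 0 := pow_ne_zero _ two_ne_zero
  simp [intVal, h']
  field_simp

theorem complexVal_one : complexVal [false, true] [] [] = 1 := by
  simp [complexVal, intVal, Nat.ofDigits]

open Classical in
/-- The value that the access programs output for the verdict `v` of `V`. -/
noncomputable def verdictEntry (k : ℕ) (v : List Bool) : ℂ :=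
  if v = [true] then ((1 - (1 / 2) ^ (k + 1) : ℝ) : ℂ) else 1

theorem eval_entryPost (k : ℕ) (w f v r : List Bool) : ∃ a b c rest,
    entryPost.eval [w, [], f, ones k, [], [], v, r] = a :: b :: c :: rest ∧
      (f = [] → complexVal a b c = verdictEntry k v) ∧ (f ≠ [] → complexVal a b c = 0) := by
  -- Off the diagonal the marks `f` remain in the exponent register, harmlessly, since the numerator
  -- is zero.
  have hz : complexVal [] [] f = 0 := by simp [complexVal, intVal]
  have hne : ∀ b g, f = b :: g → entryPost.eval [w, [], f, ones k, [], [], v, r] =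
      [[], [], f, ones k, [], [], v, r] := by
    rintro b g rfl
    have : ((Cmd.clear 0).seq (Cmd.clear 1)).eval [w, [], b :: g, ones k, [], [], v, r] =
      [[], [], b :: g, ones k, [], [], v, r] := by rw [Cmd.eval, Cmd.eval_clear, Cmd.eval_clear]; rfl
    cases b <;> exact this
  rcases f with _ | ⟨b, g⟩
  · have e : entryPost.eval [w, [], [], ones k, [], [], v, r] =
      (ifAccepted entryAccept entryReject).eval [w, [], [], ones k, [], [], v, r] := rfl
    by_cases hv : v = [true]
    · refine ⟨_, _, _, _, (e.trans ((eval_ifAccepted _ _ _ _ _ _ _ _ _ _).1 hv)).trans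
        (eval_entryAccept _ _ _ _ _ _ _), fun _ => ?_, fun h => absurd rfl h⟩
      rw [verdictEntry, if_pos hv, complexVal_ones]
    · obtain ⟨v', hv'⟩ := (eval_ifAccepted entryAccept entryReject w [] [] (ones k) [] [] v r).2 hv
      refine ⟨_, _, _, _, (e.trans hv').trans (eval_entryReject _ _ _ _ _ _ _ _), fun _ => ?_,
        fun h => absurd rfl h⟩
      rw [verdictEntry, if_neg hv, complexVal_one]
  · exact ⟨_, _, _, _, hne b g rfl, fun h => absurd h (by simp), fun _ => hz⟩

theorem eval_rowPost (k : ℕ) (w i v r : List Bool) : ∃ a b c rest,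
    rowPost.eval [w, i, [], ones k, [], [], v, r] = [true] :: i :: a :: b :: c :: rest ∧
      complexVal a b c = verdictEntry k v := by
  have e : ∀ a b c d f g h : List Bool, ((Cmd.clear 0).seq (Cmd.push 0 true)).eval
      [a, b, c, d, f, g, h, r] = [[true], b, c, d, f, g, h, r] := by
    intro a b c d f g h
    rw [Cmd.eval, Cmd.eval_clear]
    rfl
  by_cases hv : v = [true]
  · refine ⟨false :: ones (k + 1), [], ones (k + 1), [[], [], r], ?_, ?_⟩
    · rw [hv, rowPost, Cmd.eval, (eval_ifAccepted _ _ _ _ _ _ _ _ _ _).1 rfl, eval_rowAccept, e]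
    · rw [verdictEntry, if_pos hv, complexVal_ones]
  · obtain ⟨v', hv'⟩ := (eval_ifAccepted rowAccept rowReject w i [] (ones k) [] [] v r).2 hv
    refine ⟨[false, true], [], [], [[], v', r], ?_, ?_⟩
    · rw [rowPost, Cmd.eval, hv', eval_rowReject, e]
    · rw [verdictEntry, if_neg hv, complexVal_one]

/-- Run `pre`, `V` (on the registers from `6` on) and `post`, with `x` and `m` hardwired. -/
def accessProg (pre V post : Prog) (x : List Bool) (m : ℕ) : Prog :=
  chain 6 x (chain 7 (ones m) (.seq pre (.seq (V.shift 6) post)))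

theorem Runs.accessProg {pre V post : Prog} {x r v a b c d e f : List Bool} {l' : Regs}
    {i j : List Bool} {m T₁ T₂ T₃ : ℕ}
    (h₁ : Runs pre [i, j, [], [], [], [], x, ones m] [a, b, c, d, e, f, x, r] T₁)
    (h₂ : Runs V [x, r] [v, r] T₂)
    (h₃ : Runs post [a, b, c, d, e, f, v, r] l' T₃) :
    Runs (LogDetHardness.accessProg pre V post x m) [i, j] l' (x.length + (m + (T₁ + (T₂ + T₃)))) := by
  have h := h₁.seq ((h₂.shift [a, b, c, d, e, f]).seq h₃)
  have h' : Runs (LogDetHardness.chain 7 (ones m) (.seq pre (.seq (V.shift 6) post)))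
      [i, j, [], [], [], [], x, []] l' (m + (T₁ + (T₂ + T₃))) := by
    have := Runs.chain (r := 7) (w := ones m) (l := [i, j, [], [], [], [], x, []]) (by simp)
      (by simpa using h)
    simpa using this
  have h'' := Runs.chain (r := 6) (w := x) (l := [i, j, [], [], [], [], [], []]) (by simp)
      (by simpa using h')
  obtain ⟨t, ht, hex⟩ := h''
  refine ⟨t, ht, ?_⟩
  have e : inputs [i, j, [], [], [], [], [], []] = inputs [i, j] :=
    inputs_append_replicate [i, j] 6
  rw [← e]
  exact hex

/-- There are programs that answer the queries, up to calls of `V`, in time bounded by a fixed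
polynomial. -/
theorem exists_access_programs : ∃ (τ : Polynomial ℕ) (preE postE preR postR : Prog),
    ∀ (V : (Fin 2 → List Bool) → List Bool) (VP : Prog) (x : List Bool) (m n : ℕ),
      m + 1 ≤ n → x.length ≤ n →
      (∀ r : List Bool, r.length = m → Runs VP [x, r] [V ![x, r], r] n) →
      SparseAccess (countingMatrix V m x n) 1 (τ.eval n) (accessProg preE VP postE x m)
        (accessProg preR VP postR x m) (accessProg preR VP postR x m) := by
  obtain ⟨-, preE, qE, hE⟩ := entryPre.st wf_entryPre
  obtain ⟨-, postE, qE', hE'⟩ := entryPost.st wf_entryPost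
  obtain ⟨-, preR, qR, hR⟩ := rowPre.st wf_rowPre
  obtain ⟨-, postR, qR', hR'⟩ := rowPost.st wf_rowPost
  -- The three `n` pay for pushing `x`, pushing `m` ones, and running `V`. The other terms depend
  -- only on the fixed programs around `V`.
  refine ⟨3 * .X + qE.comp (4 * .X) + qE'.comp (5 * .X + qE.comp (4 * .X)) +
    (qR.comp (4 * .X) + qR'.comp (5 * .X + qR.comp (4 * .X))), preE, postE, preR, postR,
    fun V VP x m n hm hx hV => ?_⟩
  have hne : ∀ i, (countingMatrix V m x n) i i ≠ 0 := by
    intro i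
    rw [countingMatrix, Matrix.diagonal_apply_eq, Complex.ofReal_ne_zero]
    have := (diagEntry_mem V m x n i).1
    linarith
  have hrow : ∀ i j, countingMatrix V m x n i j ≠ 0 ↔ j = i := by
    intro i j
    constructor
    · intro h
      by_contra hij
      exact h (Matrix.diagonal_apply_ne _ (Ne.symm hij))
    · rintro rfl; exact hne j
  have htake : ∀ i : Fin (2 ^ n), ((indexBits i).take m).length = m := by
    intro i; simp [indexBits_length]; omega
  have hsize : ∀ (i : Fin (2 ^ n)), (indexBits i).length = n := indexBits_length
  have hdiag : ∀ i, countingMatrix V m x n i i = verdictEntry m (V ![x, (indexBits i).take m]) := by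
    intro i
    rw [countingMatrix, Matrix.diagonal_apply_eq, diagEntry, verdictEntry]
    unfold Accepts
    split_ifs <;> simp
  simp only [Polynomial.eval_add, Polynomial.eval_mul, Polynomial.eval_comp, Polynomial.eval_X,
    Polynomial.eval_ofNat]
  have hentry : ∀ i j, (accessProg preE VP postE x m).RunsTo [indexBits i, indexBits j]
      (3 * n + qE.eval (4 * n) + qE'.eval (5 * n + qE.eval (4 * n)))
      fun σ => complexVal (σ 0) (σ 1) (σ 2) = countingMatrix V m x n i j := by
    intro i j
    obtain ⟨f, hf, hfl, h0⟩ := eval_entryPre (indexBits i) (indexBits j) x (ones m)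
      (by rw [hsize, hsize]) (by rw [hsize]; simp; omega)
    rw [List.length_replicate] at h0
    have h1 := hE [indexBits i, indexBits j, [], [], [], [], x, ones m] rfl
    rw [h0] at h1
    have h2 := hV _ (htake i)
    have hs1 : size [indexBits i, indexBits j, [], [], [], [], x, ones m] ≤ 4 * n := by
      simp [hsize]; omega
    have h3 := hE' [(indexBits i).drop m, [], f, ones m, [], [],
      V ![x, (indexBits i).take m], (indexBits i).take m] rfl
    have hs3 : size [(indexBits i).drop m, [], f, ones m, [], [],
      V ![x, (indexBits i).take m], (indexBits i).take m] ≤ 5 * n + qE.eval (4 * n) := by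
      have := h2.size_le rfl
      simp [hsize] at this hfl ⊢
      omega
    obtain ⟨t, ht, hex⟩ := Runs.accessProg h1 h2 h3
    refine ⟨_, t, hex, ?_, ?_⟩
    · have a1 := eval_mono qE hs1
      have a3 := eval_mono qE' hs3
      omega
    · obtain ⟨a, b, c, rest, e1, e2, e3⟩ := eval_entryPost m ((indexBits i).drop m) f
        (V ![x, (indexBits i).take m]) ((indexBits i).take m)
      rw [e1]
      change complexVal a b c = _
      by_cases hij : i = j
      · subst hij
        rw [e2 (hf.2 rfl), hdiag]
      · rw [e3 fun h => hij (indexBits_injective (hf.1 h)), countingMatrix,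
          Matrix.diagonal_apply_ne _ hij]
  have hrowrun : ∀ i, (accessProg preR VP postR x m).RunsTo [indexBits i, []]
      (3 * n + qR.eval (4 * n) + qR'.eval (5 * n + qR.eval (4 * n)))
      fun σ => σ 0 = [true] ∧ σ 1 = indexBits i ∧
        complexVal (σ 2) (σ 3) (σ 4) = countingMatrix V m x n i i := by
    intro i
    have h0 := eval_rowPre (indexBits i) x (ones m) (by rw [hsize]; simp; omega)
    rw [List.length_replicate] at h0
    have h1 := hR [indexBits i, [], [], [], [], [], x, ones m] rfl
    rw [h0] at h1
    have h2 := hV _ (htake i)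
    have hs1 : size [indexBits i, [], [], [], [], [], x, ones m] ≤ 4 * n := by
      simp [hsize]; omega
    have h3 := hR' [(indexBits i).drop m, indexBits i, [], ones m, [], [],
      V ![x, (indexBits i).take m], (indexBits i).take m] rfl
    have hs3 : size [(indexBits i).drop m, indexBits i, [], ones m, [], [],
      V ![x, (indexBits i).take m], (indexBits i).take m] ≤ 5 * n + qR.eval (4 * n) := by
      have := h2.size_le rfl
      simp [hsize] at this ⊢
      omega
    obtain ⟨t, ht, hex⟩ := Runs.accessProg h1 h2 h3
    refine ⟨_, t, hex, ?_, ?_⟩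
    · have a1 := eval_mono qR hs1
      have a3 := eval_mono qR' hs3
      omega
    · obtain ⟨a, b, c, rest, e1, e2⟩ := eval_rowPost m ((indexBits i).drop m) (indexBits i)
        (V ![x, (indexBits i).take m]) ((indexBits i).take m)
      rw [e1]
      exact ⟨rfl, rfl, e2.trans (hdiag i).symm⟩
  have hreport : ∀ i (v : Fin (2 ^ n) → ℂ), (∀ j, v j ≠ 0 ↔ j = i) →
      v i = countingMatrix V m x n i i → ∀ l < 1,
      (accessProg preR VP postR x m).RunsTo [indexBits i, List.replicate l true]
      (3 * n + qE.eval (4 * n) + qE'.eval (5 * n + qE.eval (4 * n)) +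
        (qR.eval (4 * n) + qR'.eval (5 * n + qR.eval (4 * n)))) (ReportsNonzero v l) := by
    intro i v hv hvi l hl
    -- The sparsity is 1, so only the diagonal entry is ever asked for.
    obtain rfl : l = 0 := by omega
    obtain ⟨σ, t, hex, ht, h0, h1, h2⟩ := hrowrun i
    refine ⟨σ, t, hex, by omega, Or.inl ⟨i, (hv i).2 rfl, ?_, h0, h1, h2.trans hvi.symm⟩⟩
    rw [Set.ncard_eq_zero]
    ext j
    simp only [Set.mem_ofPred_eq, Set.mem_empty_iff_false, iff_false, not_and, hv]
    rintro h rfl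
    exact lt_irrefl _ h
  have hcol : ∀ j i, countingMatrix V m x n i j ≠ 0 ↔ i = j := by
    intro j i; rw [hrow]; exact eq_comm
  refine ⟨fun i => ?_, fun j => ?_, fun i j => ?_, fun i => hreport i _ (hrow i) rfl,
    fun j => hreport j _ (hcol j) rfl⟩
  · simp only [hrow]; simp
  · simp only [hcol]; simp
  · obtain ⟨σ, t, hex, ht, h⟩ := hentry i j
    exact ⟨σ, t, hex, by omega, h⟩

/-! ## The reduction -/

open Cmd in
/-- Push the code of `Prog.push r b` on register `3`, and save `b` in register `4`. -/
def emitBit (r : ℕ) (b : Bool) : Cmd := seq (push 4 b) (pushL 3 (pushCode r b))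

open Cmd in
/-- Push the code of `P`, preceded by pushing the contents of the registers `0` and `1`, on register
`3`. -/
def emit (P : Prog) : Cmd :=
  seq (pushL 3 P.encode) (seq (fold 1 (emitBit 7 false) (emitBit 7 true)) (seq (mv 4 1)
    (seq (fold 0 (emitBit 6 false) (emitBit 6 true)) (mv 4 0))))

theorem foldl_emitBit (r : ℕ) (w a b c u t : List Bool) :
    w.foldl (fun s y => cond y ((emitBit r true).eval s) ((emitBit r false).eval s))
      [a, b, c, u, t] =
      [a, b, c, w.foldl (fun u b => pushCode r b ++ u) u, w.reverse ++ t] := by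
  induction w generalizing u t with
  | nil => rfl
  | cons y w ih =>
    have : cond y ((emitBit r true).eval [a, b, c, u, t]) ((emitBit r false).eval [a, b, c, u, t]) =
        [a, b, c, pushCode r y ++ u, y :: t] := by
      cases y <;> simp [emitBit, Cmd.eval, Cmd.eval_pushL]
    rw [List.foldl_cons, this, ih]
    simp

theorem foldl_pushCode_append (r : ℕ) (w u v : List Bool) :
    w.foldl (fun u b => pushCode r b ++ u) (u ++ v) =
      w.foldl (fun u b => pushCode r b ++ u) u ++ v := by
  induction w generalizing u with
  | nil => rfl
  | cons b w ih => rw [List.foldl_cons, List.foldl_cons, ← ih, List.append_assoc]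

/-- The folds consume `x` and `o`, so register `4` saves each and restores it. `o` is treated before
`x` because code is written back to front. -/
theorem eval_emit (P : Prog) (x o n u : List Bool) :
    (emit P).eval [x, o, n, u, []] = [x, o, n, (chain 6 x (chain 7 o P)).encode ++ u, []] := by
  have h1 : ∀ a b c d e : List Bool,
      (Cmd.mv 4 1).eval [a, b, c, d, e] = [a, e.reverse ++ b, c, d, []] := by simp [Cmd.eval_mv]
  have h2 : ∀ a b c d e : List Bool,
      (Cmd.mv 4 0).eval [a, b, c, d, e] = [e.reverse ++ a, b, c, d, []] := by simp [Cmd.eval_mv]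
  simp only [emit, Cmd.eval]
  rw [Cmd.eval_pushL (by simp)]
  simp only [List.getD_cons_zero, List.getD_cons_succ, List.set_cons_succ, List.set_cons_zero]
  rw [foldl_emitBit, h1]
  simp only [List.getD_cons_zero, List.set_cons_zero, List.append_nil, List.reverse_reverse]
  rw [foldl_emitBit, h2]
  simp only [List.append_nil, List.reverse_reverse]
  rw [foldl_pushCode_append, foldl_pushCode_append, encode_chain, encode_chain]

theorem wf_emit (P : Prog) : (emit P).Wf 5 := by
  simp [emit, emitBit, Cmd.Wf, Cmd.Avoids, Cmd.Tame]

open Cmd in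
/-- Assemble an instance from the input in register `0`, the number of random bits in register `1`
and the dimension in register `2`. -/
def emitInstance (E R : Prog) : Cmd :=
  seq (emit R) (seq (emit R) (seq (emit E) (seq (push 3 false)
    (seq (fold 2 (push 3 true) (push 3 true)) (seq (clear 0) (seq (mv 3 4) (mv 4 0)))))))

theorem wf_emitInstance (E R : Prog) : (emitInstance E R).Wf 5 := by
  simp [emitInstance, wf_emit, Cmd.Wf, Cmd.Avoids, Cmd.Tame]

theorem eval_emitInstance (E R : Prog) (x o : List Bool) (n : ℕ) :
    (emitInstance E R).eval [x, o, ones n, [], []] =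
      [unary n ++ (chain 6 x (chain 7 o E)).encode ++ (chain 6 x (chain 7 o R)).encode ++
        (chain 6 x (chain 7 o R)).encode, o, [], [], []] := by
  have h : ∀ (n : ℕ) (u : List Bool), (Cmd.fold 2 (.push 3 true) (.push 3 true)).eval
      [x, o, ones n, u, []] = [x, o, [], ones n ++ u, []] := by
    intro n
    induction n with
    | zero => exact fun u => rfl
    | succ n ih =>
      intro u
      refine (ih (true :: u)).trans ?_
      simp [List.replicate_succ']
  rw [emitInstance, Cmd.eval, eval_emit, Cmd.eval, eval_emit, Cmd.eval, eval_emit, Cmd.eval,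
    Cmd.eval, Cmd.eval, Cmd.eval, Cmd.eval]
  simp only [List.getD_cons_zero, List.getD_cons_succ, List.set_cons_succ, List.set_cons_zero]
  rw [h, Cmd.eval_clear]
  simp [unary, Cmd.eval_mv]

/-- The map from inputs to instances is computable in polynomial time. -/
theorem polyTime_instance (M N : Polynomial ℕ) (E R : Prog) :
    PolyTime fun a : Fin 1 → List Bool =>
      unary (N.eval (a 0).length) ++
        (chain 6 (a 0) (chain 7 (ones (M.eval (a 0).length)) E)).encode ++
        (chain 6 (a 0) (chain 7 (ones (M.eval (a 0).length)) R)).encode ++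
        (chain 6 (a 0) (chain 7 (ones (M.eval (a 0).length)) R)).encode := by
  have h := ((ST.call (polyTime_ones_eval M) (k := 5) ![0] (by simp) (r := 1) (by norm_num)).comp
    (ST.call (polyTime_ones_eval N) (k := 5) ![0] (by simp) (r := 2) (by norm_num))).comp
    ((emitInstance E R).st (wf_emitInstance E R))
  refine h.polyTime (by norm_num) fun args => ?_
  have e : List.ofFn args ++ List.replicate (5 - 1) [] = [args 0, [], [], [], []] := by
    simp [List.replicate]
  rw [e]
  simp only [List.getD_cons_zero, List.set_cons_succ, List.set_cons_zero, Matrix.cons_val_fin_one]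
  rw [eval_emitInstance]
  rfl

open Cmd in
/-- Test whether the number with the digits in register `1` and the exponent in register `2` is at
most `-2 ^ K`, where `K` is the length of register `0`. -/
def threshold : Cmd :=
  seq (branch 1 skip skip (push 4 true)) (seq (pop 1) (seq (fold 0 (pop 1) (pop 1))
    (seq (fold 2 (pop 1) (pop 1)) (seq (fold 1 skip (push 3 true))
      (branch 4 (push 0 false) (push 0 false)
        (branch 3 (push 0 false) (push 0 false) (push 0 true)))))))

theorem wf_threshold : threshold.Wf 5 := by
  simp [threshold, Cmd.Wf, Cmd.Avoids, Cmd.Tame]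

theorem foldl_pop (w z a c d e : List Bool) :
    w.foldl (fun s y => cond y ((Cmd.pop 1).eval s) ((Cmd.pop 1).eval s)) [z, a, c, d, e] =
      [z, a.drop w.length, c, d, e] := by
  induction w generalizing a with
  | nil => rfl
  | cons y w ih =>
    rw [List.foldl_cons, List.length_cons, Nat.add_comm, ← List.drop_drop, List.drop_one, ← ih]
    cases y <;> rfl

theorem foldl_mark (w z a c d e : List Bool) :
    w.foldl (fun s y => cond y ((Cmd.push 3 true).eval s) (Cmd.skip.eval s)) [z, a, c, d, e] =
      [z, a, c, ones (w.count true) ++ d, e] := by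
  induction w generalizing d with
  | nil => rfl
  | cons y w ih =>
    cases y
    · exact ih d
    · refine (ih (true :: d)).trans ?_
      simp [List.replicate_succ']

theorem eval_threshold (o a k : List Bool) :
    (threshold.eval [o, a, k, [], []]).getD 0 [] =
      [decide (a.head? = some true ∧ true ∈ a.tail.drop (o.length + k.length))] := by
  have h : ∀ e : List Bool, (((Cmd.fold 0 (.pop 1) (.pop 1)).seq ((Cmd.fold 2 (.pop 1) (.pop 1)).seq
      (.fold 1 .skip (.push 3 true)))).eval [o, a.tail, k, [], e]) =
        [[], [], [], ones ((a.tail.drop (o.length + k.length)).count true), e] := by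
    intro e
    simp only [Cmd.eval.eq_4, Cmd.eval.eq_6]
    simp only [List.getD_cons_zero, List.set_cons_zero]
    rw [foldl_pop]
    simp only [List.getD_cons_zero, List.getD_cons_succ, List.set_cons_succ, List.set_cons_zero]
    rw [foldl_pop]
    simp only [List.getD_cons_zero, List.getD_cons_succ, List.set_cons_succ, List.set_cons_zero]
    rw [foldl_mark, List.drop_drop, List.append_nil]
  have h' : ∀ e : List Bool, (Cmd.branch 1 .skip .skip (.push 4 true)).eval [o, a, k, [], []] =
      [o, a, k, [], e] → (threshold.eval [o, a, k, [], []]) =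
      (Cmd.branch 4 (.push 0 false) (.push 0 false)
        (.branch 3 (.push 0 false) (.push 0 false) (.push 0 true))).eval
        [[], [], [], ones ((a.tail.drop (o.length + k.length)).count true), e] := by
    intro e he
    rw [← h e, threshold, Cmd.eval, he]
    rfl
  rcases a with _ | ⟨_ | _, w⟩
  · rw [h' [] rfl]; simp [Cmd.eval, sel]
  · rw [h' [] rfl]; simp [Cmd.eval, sel]
  · rw [h' [true] rfl]
    simp only [List.head?_cons, List.tail_cons, true_and]
    by_cases hw : true ∈ w.drop (o.length + k.length)
    · obtain ⟨c, hc⟩ := Nat.exists_eq_succ_of_ne_zero (List.count_pos_iff.2 hw).ne'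
      rw [hc]
      simp [hw, Cmd.eval, sel, ones_succ]
    · rw [List.count_eq_zero.2 hw]
      simp [hw, Cmd.eval, sel]

theorem polyTime_threshold (K : Polynomial ℕ) :
    PolyTime fun a : Fin 3 → List Bool =>
      [decide ((a 1).head? = some true ∧
        true ∈ (a 1).tail.drop (K.eval (a 0).length + (a 2).length))] := by
  have h := (ST.call (polyTime_ones_eval K) (k := 5) ![0] (by simp) (r := 0) (by norm_num)).comp
    (threshold.st wf_threshold)
  refine h.polyTime (by norm_num) fun args => ?_
  have e : List.ofFn args ++ List.replicate (5 - 3) [] = [args 0, args 1, args 2, [], []] := by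
    simp [List.replicate]
  rw [e]
  simp only [List.getD_cons_zero, List.set_cons_zero, Matrix.cons_val_fin_one]
  rw [eval_threshold]
  simp

/-- There is a running time for which estimating `log det` of `1`-sparse matrices with condition
number at most `2` up to a small constant is PP-hard. -/
theorem exists_isHard_PP : ∃ τ : Polynomial ℕ, ∀ ε : ℕ → ℝ, (∀ n, 2 ≤ n → ε n ≤ 1 / 4) →
    IsHard PP (logDetEstimation 2 1 τ ε) := by
  obtain ⟨τ, preE, postE, preR, postR, hacc⟩ := exists_access_programs
  refine ⟨τ, fun ε hε L hL => ?_⟩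
  obtain ⟨V, M, hV, hyes, hno⟩ := hL
  -- In this form `V` keeps its coins and leaves no garbage, so the program that follows it meets a
  -- known store.
  obtain ⟨-, VP, q, hVP⟩ := ST.call hV (k := 2) ![0, 1] (by simp [Fin.forall_fin_two]) (r := 0)
    (by norm_num)
  -- `K` dominates |x|, `m + 1` and the running time of `V` on |x| + m bits.
  let K : Polynomial ℕ := .X + M + 1 + q.comp (.X + M)
  let N : Polynomial ℕ := M + 2 + K
  let E : Prog := .seq preE (.seq (VP.shift 6) postE)
  let R : Prog := .seq preR (.seq (VP.shift 6) postR)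
  refine ⟨_, _, polyTime_instance M N E R, polyTime_threshold K, fun x hx => ?_⟩
  simp only [Matrix.cons_val_zero, Matrix.cons_val_one, Matrix.cons_val]
  set m := M.eval x.length with hm
  set k := K.eval x.length with hk
  have hn : N.eval x.length = m + 2 + k := by simp [N, hm, hk]
  have hk' : k = x.length + m + 1 + q.eval (x.length + m) := by simp [K, hk, hm]
  rw [hn]
  have hdesc : DescribesMatrix 2 1 τ
      (unary (m + 2 + k) ++ (chain 6 x (chain 7 (ones m) E)).encode ++
        (chain 6 x (chain 7 (ones m) R)).encode ++ (chain 6 x (chain 7 (ones m) R)).encode)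
      (m + 2 + k) (countingMatrix V m x (m + 2 + k)) := by
    refine ⟨⟨_, _, _, rfl, ?_⟩, posSemidef_countingMatrix V m x _, ?_⟩
    · rw [Polynomial.eval_one]
      refine hacc V VP x m _ (by omega) (by omega) fun r hr => ?_
      have h := hVP [x, r] rfl
      have e : (fun i : Fin 2 => ([x, r] : Regs).getD (![0, 1] i) []) = ![x, r] := by
        funext i; fin_cases i <;> rfl
      change Runs VP [x, r] [V fun i : Fin 2 => ([x, r] : Regs).getD (![0, 1] i) [], r] _ at h
      rw [e] at h
      refine h.mono ?_
      simp [hr]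
      omega
    · simpa using spectrum_countingMatrix V m x (m + 2 + k)
  refine ⟨⟨_, _, hdesc⟩, fun a b hz => ?_⟩
  obtain ⟨n', A', hA', hz⟩ := hz
  -- The estimate is for some matrix with this code; its determinant is that of `countingMatrix`.
  obtain ⟨hdet, hnn⟩ := hdesc.unique hA'
  rw [← hdet, ← hnn] at hz
  obtain ⟨h1, h2⟩ := estimate_decides V m x (K := k) (by omega) (hz.trans (hε _ (by omega)))
  rw [realVal_le_neg_two_pow_iff] at h1 h2
  constructor
  · intro hxy
    simpa using h1 (hyes x hxy)
  · intro hxn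
    exact congrArg (fun b => [b]) (decide_eq_false (h2 (hno x hxn)))

end LogDetHardness

theorem theorem5p3 :
    ∃ κ s τ : Polynomial ℕ, (∀ n : ℕ, 0 < κ.eval n) ∧
      (∃ p : Polynomial ℕ, (∀ n : ℕ, 0 < p.eval n) ∧
        IsHard BQP (logDetEstimation κ s τ fun n => 1 / ((p.eval n : ℕ) : ℝ))) ∧
      IsHard PP (logDetEstimation κ s τ fun n => Real.exp (-(n : ℝ))) := by
  obtain ⟨τ, h⟩ := exists_isHard_PP
  -- Accuracy 1/4 already suffices, so the polynomial in the BQP part is the constant 4.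
  refine ⟨2, 1, τ, fun n => by simp, ⟨4, fun n => by simp, fun L hL => ?_⟩, ?_⟩
  · exact h _ (fun n _ => by simp) L (BQP_subset_PP hL)
  · refine h _ fun n hn => ?_
    have h1 : Real.exp (-(n : ℝ)) ≤ Real.exp (-2) :=
      Real.exp_le_exp.2 (neg_le_neg (by exact_mod_cast hn))
    refine h1.trans ?_
    have h2 : (2 : ℝ) ≤ Real.exp 1 := by
      have := Real.add_one_le_exp (1 : ℝ); linarith
    -- As e ≥ 2, e^-n ≤ 1/4 from n = 2 on, and all instances of the reduction have n ≥ 2.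
    have h3 : (4 : ℝ) ≤ Real.exp 2 := by
      rw [show (2 : ℝ) = 1 + 1 by norm_num, Real.exp_add]; nlinarith
    rw [Real.exp_neg, ← one_div]
    exact one_div_le_one_div_of_le (by norm_num) h3
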